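/- Let $n\ge 3$ and let $M$ be a nonempty smooth $n$-manifold (Hausdorff, second countable, without boundary, all components of dimension $n$; neither compactness nor connectedness is assumed). Let $\mathrm{Metr}(M)$ be the set of smooth Riemannian metrics on $M$. For $g\in\mathrm{Metr}(M)$ put $$Y_M(g)=\inf\left\{\frac{\int_M\big(a_n|dv|_g^2+\mathrm{scal}_g\,v^2\big)\,d\mu_g}{\|v\|_{L^{p}(g)}^{2}}\ :\ v\in C_c^\infty(M,\mathbb{R}_{\ge0})\setminus\{0\}\right\}\in\mathbb{R}\cup\{-\infty\},$$ where $a_n=\frac{4(n-1)}{n-2}$, $p=\frac{2n}{n-2}$, $\mathrm{scal}_g$ is the scalar curvature of $g$ and $\mu_g$ is its Riemannian volume measure. The fine (strong, Whitney) $C^2$-topology on $\mathrm{Metr}(M)$ is the topology in which a neighbourhood basis at $g$ is given by the sets $\{h\in\mathrm{Metr}(M) : j^2_xh\in U \text{ for all } x\in M\}$, where $U$ runs over the open neighbourhoods of $\{j^2_xg : x\in M\}$ in the total space of the bundle of $2$-jets of Riemannian metrics on $M$. Then the set $\{g\in\mathrm{Metr}(M) : Y_M(g)=-\infty\}$ is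 both open and closed with respect to the fine $C^2$-topology on $\mathrm{Metr}(M)$. -/

import Mathlib

open Bundle Manifold MeasureTheory
open scoped ContDiff Topology

/-- `Metr n M` is the set of smooth Riemannian metrics on the `n`-manifold `M`, i.e. of smooth
families of positive definite symmetric bilinear forms on the tangent spaces. -/
abbrev Metr (n : ℕ) (M : Type*) [TopologicalSpace M] [ChartedSpace (EuclideanSpace ℝ (Fin n)) M]
    [IsManifold (𝓡 n) ∞ M] : Type _ :=
  ContMDiffRiemannianMetric (𝓡 n) ∞ (EuclideanSpace ℝ (Fin n))
    (fun x : M ↦ TangentSpace (𝓡 n) x)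

noncomputable section

namespace YamabeConst

/-! ### Riemannian geometry in coordinates -/

section Coordinates

variable {n : ℕ}

/-- The `i`-th partial derivative of a function on `ℝⁿ`. -/
def pderiv (i : Fin n) (f : EuclideanSpace ℝ (Fin n) → ℝ) (y : EuclideanSpace ℝ (Fin n)) : ℝ :=
  fderiv ℝ f y (EuclideanSpace.single i 1)

/-- The Christoffel symbol `Γᵏᵢⱼ = ½ ∑ₗ Gᵏˡ (∂ᵢ Gⱼₗ + ∂ⱼ Gᵢₗ - ∂ₗ Gᵢⱼ)` of a metric `G` on (an open
subset of) `ℝⁿ`, where `Gᵏˡ` are the entries of the inverse matrix. -/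
def christoffel (G : EuclideanSpace ℝ (Fin n) → Matrix (Fin n) (Fin n) ℝ) (k i j : Fin n)
    (y : EuclideanSpace ℝ (Fin n)) : ℝ :=
  (1 / 2 : ℝ) * ∑ l, (G y)⁻¹ k l *
    (pderiv i (fun z ↦ G z j l) y + pderiv j (fun z ↦ G z i l) y - pderiv l (fun z ↦ G z i j) y)

/-- The Ricci curvature
`Ricᵢⱼ = ∑ₖ (∂ₖ Γᵏᵢⱼ - ∂ⱼ Γᵏᵢₖ) + ∑ₖₗ (Γᵏₖₗ Γˡᵢⱼ - Γᵏⱼₗ Γˡᵢₖ)` of a metric `G` in coordinates. -/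
def ricci (G : EuclideanSpace ℝ (Fin n) → Matrix (Fin n) (Fin n) ℝ) (i j : Fin n)
    (y : EuclideanSpace ℝ (Fin n)) : ℝ :=
  (∑ k, (pderiv k (christoffel G k i j) y - pderiv j (christoffel G k i k) y)) +
    ∑ k, ∑ l, (christoffel G k k l y * christoffel G l i j y -
      christoffel G k j l y * christoffel G l i k y)

/-- The scalar curvature `∑ᵢⱼ Gⁱʲ Ricᵢⱼ` of a metric `G` in coordinates. -/
def scalCoord (G : EuclideanSpace ℝ (Fin n) → Matrix (Fin n) (Fin n) ℝ)
    (y : EuclideanSpace ℝ (Fin n)) : ℝ :=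
  ∑ i, ∑ j, (G y)⁻¹ i j * ricci G i j y

end Coordinates

theorem exists_chartSeq (n : ℕ) (M : Type*) [TopologicalSpace M]
    [ChartedSpace (EuclideanSpace ℝ (Fin n)) M] [SecondCountableTopology M] [Nonempty M] :
    ∃ c : ℕ → M, (⋃ i, (chartAt (EuclideanSpace ℝ (Fin n)) (c i)).source) = Set.univ := by
  obtain ⟨s, hs, hU⟩ := TopologicalSpace.countable_cover_nhds
    (fun x : M ↦ chart_source_mem_nhds (EuclideanSpace ℝ (Fin n)) x)
  have hne : s.Nonempty := by
    rcases s.eq_empty_or_nonempty with h | h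
    · subst h
      obtain ⟨x⟩ := ‹Nonempty M›
      have hx := Set.mem_univ x
      rw [← hU] at hx
      simp at hx
    · exact h
  obtain ⟨c, rfl⟩ := hs.exists_eq_range hne
  exact ⟨c, by rw [← hU, Set.biUnion_range]⟩

section Manifold

variable {n : ℕ} {M : Type*} [TopologicalSpace M] [ChartedSpace (EuclideanSpace ℝ (Fin n)) M]
  [IsManifold (𝓡 n) ∞ M]

/-- The coefficient matrix `gᵢⱼ = g(∂ᵢ, ∂ⱼ)` of the metric `g` in the chart `e`, as a function
on the target of `e`; here `∂ᵢ` is the image of the `i`-th standard basis vector under the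
differential of the inverse chart. -/
def metricCoeff (e : OpenPartialHomeomorph M (EuclideanSpace ℝ (Fin n))) (g : Metr n M)
    (y : EuclideanSpace ℝ (Fin n)) : Matrix (Fin n) (Fin n) ℝ :=
  Matrix.of fun i j ↦ g.inner (e.symm y)
    (mfderiv (𝓡 n) (𝓡 n) e.symm y (EuclideanSpace.single i (1 : ℝ)))
    (mfderiv (𝓡 n) (𝓡 n) e.symm y (EuclideanSpace.single j (1 : ℝ)))

/-- The scalar curvature `scal_g : M → ℝ`. It is computed at `x` in the preferred chart at `x`. -/
def scal (g : Metr n M) (x : M) : ℝ :=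
  scalCoord (metricCoeff (chartAt (EuclideanSpace ℝ (Fin n)) x) g)
    (chartAt (EuclideanSpace ℝ (Fin n)) x x)

/-- `|dv|_g²` at the point `x`: the square of the norm of the linear form `dv(x)` that is dual to
the norm which `g` defines on the tangent space at `x`. -/
def normSqDiff (g : Metr n M) (v : M → ℝ) (x : M) : ℝ :=
  sSup {r : ℝ | ∃ X : TangentSpace (𝓡 n) x, g.inner x X X ≤ 1 ∧
    let t : ℝ := mfderiv (𝓡 n) 𝓘(ℝ, ℝ) v x X
    r = t ^ 2}

/-! ### The Riemannian measure -/

variable (n M) in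
/-- A sequence of points of `M` whose preferred charts cover `M`. -/
def chartSeq [SecondCountableTopology M] [Nonempty M] : ℕ → M :=
  (exists_chartSeq n M).choose

/-- The volume measure (density) `μ_g` of the metric `g`: `M` is cut into the countably many
disjoint Borel pieces `Aᵢ = source φᵢ \ ⋃_{j < i} source φⱼ`, for a sequence of charts `φᵢ` that
cover `M`, and on the piece `Aᵢ` the measure is given by the density `√det(g_kl)` with respect to
Lebesgue measure in the chart `φᵢ`. (By the transformation formula, the result does not depend on
the choice of the charts.) -/
def volMeasure [SecondCountableTopology M] [Nonempty M] [MeasurableSpace M] (g : Metr n M) :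
    Measure M :=
  Measure.sum fun i : ℕ ↦
    let e : ℕ → OpenPartialHomeomorph M (EuclideanSpace ℝ (Fin n)) :=
      fun j ↦ chartAt (EuclideanSpace ℝ (Fin n)) (chartSeq n M j)
    let A : Set M := disjointed (fun j ↦ (e j).source) i
    (((volume : Measure (EuclideanSpace ℝ (Fin n))).restrict
      ((e i).target ∩ (e i).symm ⁻¹' A)).withDensity
        fun y ↦ ENNReal.ofReal (Real.sqrt (metricCoeff (e i) g y).det)).map (e i).symm

/-! ### The Yamabe constant -/

/-- The Yamabe functional
`‖v‖_{L^p(g)}⁻² ∫_M (a_n |dv|_g² + scal_g v²) dμ_g` with `p = 2n/(n-2)`, `a_n = 4(n-1)/(n-2)`. -/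
def yamabeFunctional [SecondCountableTopology M] [Nonempty M] [MeasurableSpace M]
    (g : Metr n M) (v : M → ℝ) : ℝ :=
  let p : ℝ := 2 * (n : ℝ) / ((n : ℝ) - 2)
  let a : ℝ := 4 * ((n : ℝ) - 1) / ((n : ℝ) - 2)
  (∫ x, (a * normSqDiff g v x + scal g x * v x ^ 2) ∂(volMeasure g)) /
    ((∫ x, v x ^ p ∂(volMeasure g)) ^ (1 / p)) ^ 2

variable (n M) in
/-- The test functions: nonnegative, compactly supported smooth functions on `M` that do not vanish
identically. -/
def testFunctions : Set (M → ℝ) :=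
  {v | ContMDiff (𝓡 n) 𝓘(ℝ, ℝ) ∞ v ∧ HasCompactSupport v ∧ (∀ x, 0 ≤ v x) ∧ v ≠ 0}

/-- The Yamabe constant `Y_M(g) ∈ ℝ ∪ {-∞}`, the infimum of the Yamabe functional over all test
functions; `-∞` is `⊥ : EReal`. -/
def yamabeConstant [SecondCountableTopology M] [Nonempty M] [MeasurableSpace M]
    (g : Metr n M) : EReal :=
  ⨅ v ∈ testFunctions n M, ((yamabeFunctional g v : ℝ) : EReal)

/-! ### The fine `C²`-topology -/

/-- The coordinates of the 2-jet of the metric `g` at the point `x`, with respect to the chart `e`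
(which must have `x` in its domain): the coordinates of `x`, and the values, the first and the
second partial derivatives at this point of the coefficients of `g`. -/
def jetCoord (e : OpenPartialHomeomorph M (EuclideanSpace ℝ (Fin n))) (q : M × Metr n M) :
    EuclideanSpace ℝ (Fin n) × (Fin n → Fin n → ℝ) × (Fin n → Fin n → Fin n → ℝ) ×
      (Fin n → Fin n → Fin n → Fin n → ℝ) :=
  (e q.1,
    fun i j ↦ metricCoeff e q.2 (e q.1) i j,
    fun k i j ↦ pderiv k (fun z ↦ metricCoeff e q.2 z i j) (e q.1),
    fun l k i j ↦ pderiv l (pderiv k (fun z ↦ metricCoeff e q.2 z i j)) (e q.1))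

variable (n M) in
/-- `(x, g)` and `(y, h)` define the same 2-jet iff `x = y` and the coefficients of `g`, `h` in
charts around this point have the same derivatives of order at most two there. -/
def jetSetoid : Setoid (M × Metr n M) where
  r q q' := q.1 = q'.1 ∧
    ∀ e ∈ atlas (EuclideanSpace ℝ (Fin n)) M, q.1 ∈ e.source → jetCoord e q = jetCoord e q'
  iseqv :=
    { refl := fun _ ↦ ⟨rfl, fun _ _ _ ↦ rfl⟩
      symm := fun h ↦ ⟨h.1.symm, fun e he hx ↦ (h.2 e he (h.1 ▸ hx)).symm⟩
      trans := fun h h' ↦ ⟨h.1.trans h'.1, fun e he hx ↦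
        (h.2 e he hx).trans (h'.2 e he (h.1 ▸ hx))⟩ }

variable (n M) in
/-- The total space of the bundle `J²(Sym²₊ T*M)` of 2-jets of Riemannian metrics on `M`. (Every
2-jet of a Riemannian metric defined near a point is also the 2-jet of a metric on all of `M`, so
that global metrics suffice as representatives.) -/
def JetBundle : Type _ := Quotient (jetSetoid n M)

/-- The 2-jet `j²ₓ g`. -/
def jet (g : Metr n M) (x : M) : JetBundle n M := Quotient.mk (jetSetoid n M) (x, g)

/-- The topology of the total space of the jet bundle, generated by the sets of jets over the
domain of a chart whose coordinates lie in an open set. -/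
instance : TopologicalSpace (JetBundle n M) :=
  TopologicalSpace.generateFrom
    {V | ∃ e ∈ atlas (EuclideanSpace ℝ (Fin n)) M, ∃ W, IsOpen W ∧
      V = Quotient.mk (jetSetoid n M) '' {q | q.1 ∈ e.source ∧ jetCoord e q ∈ W}}

variable (n M) in
/-- The fine (strong, Whitney) `C²`-topology on the set of Riemannian metrics: a neighbourhood
basis at `g` is given by the sets `{h | graph (j² h) ⊆ U}`, where `U` runs over the open
neighbourhoods of `graph (j² g)` in the total space of the 2-jet bundle. -/
@[reducible] def fineC2Topology : TopologicalSpace (Metr n M) where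
  IsOpen A := ∀ g ∈ A, ∃ U : Set (JetBundle n M), IsOpen U ∧ Set.range (jet g) ⊆ U ∧
    {h : Metr n M | Set.range (jet h) ⊆ U} ⊆ A
  isOpen_univ := fun _ _ ↦ ⟨Set.univ, isOpen_univ, Set.subset_univ _, Set.subset_univ _⟩
  isOpen_inter := by
    rintro A B hA hB g ⟨hgA, hgB⟩
    obtain ⟨U, hU, hgU, hUA⟩ := hA g hgA
    obtain ⟨V, hV, hgV, hVB⟩ := hB g hgB
    exact ⟨U ∩ V, hU.inter hV, Set.subset_inter hgU hgV, fun h hh ↦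
      ⟨hUA (hh.trans Set.inter_subset_left), hVB (hh.trans Set.inter_subset_right)⟩⟩
  isOpen_sUnion := by
    rintro S hS g ⟨A, hAS, hgA⟩
    obtain ⟨U, hU, hgU, hUA⟩ := hS A hAS g hgA
    exact ⟨U, hU, hgU, fun h hh ↦ ⟨A, hAS, hUA hh⟩⟩

end Manifold

end YamabeConst

end

/-! Finiteness of the Yamabe constant is locally constant in the fine `C²`-topology; hence the set
where it is `-∞` and its complement are both open.

Fix `g` and write the functionals of all metrics `k` near `g` as integrals against `μ_g`. The
numerator becomes `E_k(v) = ∫ (P_k v + S_k v²) dμ_g`, with `P_k v` the weighted `|dv|²` and `S_k`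
the weighted scalar curvature. The denominator is comparable to `V(v) = ‖v‖²` in `L^p(μ_g)`. So
`Y(k)` is finite iff `E_k ≥ -κ V` for some `κ ≥ 0` (`yamabeConstant_ne_bot_iff`).

To pass from `k` to `k'`, the difference of the energies must be absorbed. It contains `|dv|²`,
which `E_k` and `V` need not control globally. A local bound does exist: let `K i` exhaust `M`, and
let the angle `θ i` be `π/2` on `K i` and `0` off `K (i + 1)`. Inserting `cos (θ i) v` into the
lower bound for `k` yields `∫ sin² (θ i) P_k v ≤ 2 (E_k + κ V) + 2 Bᵢ mᵢ V`. Here `Bᵢ` bounds `2 P_k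
(θ i) + |S_k|` on `K (i + 1)`, and Hölder on this compact set bounds `∫ v²` by `mᵢ V`. If the
relative error at points first reached by `K i` is `ηᵢ`, with `∑ 2 ηᵢ ≤ 1` and `∑ 3 ηᵢ Bᵢ mᵢ ≤ 1`,
summation gives `E_k' ≥ E_k - (E_k + κ V) - V = -(κ + 1) V` (`energy_lower_bound`).

The constants `Bᵢ`, `mᵢ` can be taken from `g` alone, so the admissible errors are fixed before `k`
and `k'` are chosen (`exists_closeness`), and the two metrics can be interchanged. A fine
neighbourhood of `g` enforces any prescribed decay of the errors, since coefficients, scalar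
curvature and volume density are continuous in the 2-jet (`exists_isOpen_closeAt_exhaustion`). This
uses that scalar curvature and volume ratio do not depend on the chart, and that `μ_g` is finite on
compact sets. -/

noncomputable section

namespace YamabeConst

/-! ### Calculus of partial derivatives and matrix-valued functions on `ℝⁿ` -/

section Coordinates

variable {n : ℕ}

theorem ContDiffOn.pderiv {f : EuclideanSpace ℝ (Fin n) → ℝ} {s : Set (EuclideanSpace ℝ (Fin n))}
    (hs : IsOpen s) (hf : ContDiffOn ℝ ∞ f s)
    (i : Fin n) : ContDiffOn ℝ ∞ (pderiv i f) s :=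
  (hf.fderiv_of_isOpen hs (m := ∞) le_rfl).clm_apply contDiffOn_const

theorem differentiableAt_of_contDiffOn {f : EuclideanSpace ℝ (Fin n) → ℝ}
    {s : Set (EuclideanSpace ℝ (Fin n))} (hs : IsOpen s)
    (hf : ContDiffOn ℝ ∞ f s) {y : EuclideanSpace ℝ (Fin n)}
      (hy : y ∈ s) : DifferentiableAt ℝ f y :=
  (hf.contDiffAt (hs.mem_nhds hy)).differentiableAt (by simp)

theorem pderiv_congr {f g : EuclideanSpace ℝ (Fin n) → ℝ} {s : Set (EuclideanSpace ℝ (Fin n))}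
    (hs : IsOpen s) (h : ∀ z ∈ s, f z = g z)
    {y : EuclideanSpace ℝ (Fin n)} (hy : y ∈ s) (i : Fin n) : pderiv i f y = pderiv i g y := by
  have : f =ᶠ[𝓝 y] g := Filter.eventually_of_mem (hs.mem_nhds hy) h
  simp only [pderiv, this.fderiv_eq]

theorem pderiv_mul {f g : EuclideanSpace ℝ (Fin n) → ℝ} {y : EuclideanSpace ℝ (Fin n)}
    (hf : DifferentiableAt ℝ f y)
    (hg : DifferentiableAt ℝ g y) (i : Fin n) :
    pderiv i (fun z ↦ f z * g z) y = pderiv i f y * g y + f y * pderiv i g y := by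
  simp only [pderiv, fderiv_fun_mul hf hg]
  simp
  ring

theorem pderiv_add {f g : EuclideanSpace ℝ (Fin n) → ℝ} {y : EuclideanSpace ℝ (Fin n)}
    (hf : DifferentiableAt ℝ f y)
    (hg : DifferentiableAt ℝ g y) (i : Fin n) :
    pderiv i (fun z ↦ f z + g z) y = pderiv i f y + pderiv i g y := by
  simp only [pderiv, fderiv_fun_add hf hg]
  simp

theorem pderiv_sub {f g : EuclideanSpace ℝ (Fin n) → ℝ} {y : EuclideanSpace ℝ (Fin n)}
    (hf : DifferentiableAt ℝ f y)
    (hg : DifferentiableAt ℝ g y) (i : Fin n) :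
    pderiv i (fun z ↦ f z - g z) y = pderiv i f y - pderiv i g y := by
  simp only [pderiv, fderiv_fun_sub hf hg]
  simp

theorem pderiv_sum {ι : Type*} {t : Finset ι} {f : ι → EuclideanSpace ℝ (Fin n) → ℝ}
    {y : EuclideanSpace ℝ (Fin n)}
    (hf : ∀ k ∈ t, DifferentiableAt ℝ (f k) y) (i : Fin n) :
    pderiv i (fun z ↦ ∑ k ∈ t, f k z) y = ∑ k ∈ t, pderiv i (f k) y := by
  simp only [pderiv, fderiv_fun_sum hf]
  simp

theorem pderiv_comm {f : EuclideanSpace ℝ (Fin n) → ℝ} {s : Set (EuclideanSpace ℝ (Fin n))}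
    (hs : IsOpen s) (hf : ContDiffOn ℝ ∞ f s)
    {y : EuclideanSpace ℝ (Fin n)} (hy : y ∈ s) (i j : Fin n) :
    pderiv i (pderiv j f) y = pderiv j (pderiv i f) y := by
  have hfa := hf.contDiffAt (hs.mem_nhds hy)
  have hd : DifferentiableAt ℝ (fderiv ℝ f) y :=
    (((hf.fderiv_of_isOpen hs (m := ∞) le_rfl).contDiffAt (hs.mem_nhds hy))).differentiableAt
      (by simp)
  have hsym := hfa.isSymmSndFDerivAt
    (by simpa using (WithTop.coe_le_coe.2 le_top : ((2 : ℕ∞) : WithTop ℕ∞) ≤ ∞))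
  have key : ∀ a b : Fin n, pderiv a (pderiv b f) y =
      fderiv ℝ (fderiv ℝ f) y (EuclideanSpace.single a 1) (EuclideanSpace.single b 1) := by
    intro a b
    have : pderiv b f = fun z ↦ fderiv ℝ f z (EuclideanSpace.single b 1) := rfl
    rw [this]
    simp only [pderiv]
    rw [fderiv_clm_apply hd (differentiableAt_const _)]
    simp
  rw [key, key, hsym]

/-- The Jacobi matrix of `τ`. -/
def jacobi (τ : EuclideanSpace ℝ (Fin n) → EuclideanSpace ℝ (Fin n))
    (y : EuclideanSpace ℝ (Fin n)) : Matrix (Fin n) (Fin n) ℝ :=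
  Matrix.of fun a i ↦ pderiv i (fun z ↦ τ z a) y

theorem single_eq_basis_sum (v : EuclideanSpace ℝ (Fin n)) :
    v = ∑ a, v a • EuclideanSpace.single a (1 : ℝ) := by
  ext k
  simp [Finset.sum_apply, Pi.single_apply]

theorem fderiv_apply_eq_jacobi {τ : EuclideanSpace ℝ (Fin n) → EuclideanSpace ℝ (Fin n)}
    {y : EuclideanSpace ℝ (Fin n)} (hτ : DifferentiableAt ℝ τ y) (a i : Fin n) :
    fderiv ℝ τ y (EuclideanSpace.single i 1) a = jacobi τ y a i := by
  have h := ((EuclideanSpace.proj (𝕜 := ℝ) a).hasFDerivAt.comp y hτ.hasFDerivAt).fderiv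
  have h2 : pderiv i (fun z ↦ τ z a) y =
      fderiv ℝ (⇑(EuclideanSpace.proj (𝕜 := ℝ) a) ∘ τ) y (EuclideanSpace.single i 1) := rfl
  simp only [jacobi, Matrix.of_apply, h2, h]
  simp

theorem pderiv_comp {f : EuclideanSpace ℝ (Fin n) → ℝ}
    {τ : EuclideanSpace ℝ (Fin n) → EuclideanSpace ℝ (Fin n)} {y : EuclideanSpace ℝ (Fin n)}
      (hf : DifferentiableAt ℝ f (τ y))
    (hτ : DifferentiableAt ℝ τ y) (i : Fin n) :
    pderiv i (fun z ↦ f (τ z)) y = ∑ a, jacobi τ y a i * pderiv a f (τ y) := by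
  have h := (hf.hasFDerivAt.comp y hτ.hasFDerivAt).fderiv
  have h2 : pderiv i (fun z ↦ f (τ z)) y = fderiv ℝ (f ∘ τ) y (EuclideanSpace.single i 1) := rfl
  rw [h2, h, ContinuousLinearMap.comp_apply,
    single_eq_basis_sum (fderiv ℝ τ y (EuclideanSpace.single i 1)), map_sum]
  simp only [map_smul, smul_eq_mul, fderiv_apply_eq_jacobi hτ]
  rfl

/-- A matrix valued function all whose entries are smooth on `s`. -/
def SmoothMatOn (A : EuclideanSpace ℝ (Fin n) → Matrix (Fin n) (Fin n) ℝ)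
    (s : Set (EuclideanSpace ℝ (Fin n))) : Prop :=
  ∀ i j, ContDiffOn ℝ ∞ (fun z ↦ A z i j) s

/-- The entrywise partial derivative of a matrix valued function. -/
def mpderiv (l : Fin n) (A : EuclideanSpace ℝ (Fin n) → Matrix (Fin n) (Fin n) ℝ)
    (y : EuclideanSpace ℝ (Fin n)) :
    Matrix (Fin n) (Fin n) ℝ :=
  Matrix.of fun i j ↦ pderiv l (fun z ↦ A z i j) y

section SmoothMat

variable {A B : EuclideanSpace ℝ (Fin n) → Matrix (Fin n) (Fin n) ℝ}
    {s : Set (EuclideanSpace ℝ (Fin n))} {y : EuclideanSpace ℝ (Fin n)}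

theorem SmoothMatOn.mpderiv (hA : SmoothMatOn A s) (hs : IsOpen s) (l : Fin n) :
    SmoothMatOn (mpderiv l A) s := fun i j ↦ ContDiffOn.pderiv hs (hA i j) l

theorem SmoothMatOn.mul (hA : SmoothMatOn A s) (hB : SmoothMatOn B s) :
    SmoothMatOn (fun z ↦ A z * B z) s := fun i j ↦ by
  simp only [Matrix.mul_apply]
  exact ContDiffOn.sum fun k _ ↦ (hA i k).mul (hB k j)

theorem SmoothMatOn.transpose (hA : SmoothMatOn A s) :
    SmoothMatOn (fun z ↦ (A z).transpose) s := fun i j ↦ hA j i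

theorem SmoothMatOn.sum {ι : Type*} {t : Finset ι}
    {F : ι → EuclideanSpace ℝ (Fin n) → Matrix (Fin n) (Fin n) ℝ}
    (hF : ∀ k, SmoothMatOn (F k) s) : SmoothMatOn (fun z ↦ ∑ k ∈ t, F k z) s := fun i j ↦ by
  simp only [Matrix.sum_apply]
  exact ContDiffOn.sum fun k _ ↦ hF k i j

theorem SmoothMatOn.smul {f : EuclideanSpace ℝ (Fin n) → ℝ} (hf : ContDiffOn ℝ ∞ f s)
    (hA : SmoothMatOn A s) :
    SmoothMatOn (fun z ↦ f z • A z) s := fun i j ↦ hf.mul (hA i j)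

theorem SmoothMatOn.det (hA : SmoothMatOn A s) : ContDiffOn ℝ ∞ (fun z ↦ (A z).det) s := by
  simp only [Matrix.det_apply]
  refine ContDiffOn.sum fun σ _ ↦ ?_
  simp only [Units.smul_def, zsmul_eq_mul]
  exact contDiffOn_const.mul (contDiffOn_prod fun i _ ↦ hA _ _)

theorem SmoothMatOn.inv (hA : SmoothMatOn A s) (hdet : ∀ z ∈ s, (A z).det ≠ 0) :
    SmoothMatOn (fun z ↦ (A z)⁻¹) s := fun i j ↦ by
  simp only [Matrix.inv_def, Ring.inverse_eq_inv', Matrix.smul_apply, smul_eq_mul,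
    Matrix.adjugate_apply]
  refine (hA.det.inv hdet).mul (SmoothMatOn.det fun k l ↦ ?_)
  by_cases h : k = j
  · subst h
    simpa using contDiffOn_const
  · simpa [Matrix.updateRow_ne h] using hA k l

theorem SmoothMatOn.comp {τ : EuclideanSpace ℝ (Fin n) → EuclideanSpace ℝ (Fin n)}
    {t : Set (EuclideanSpace ℝ (Fin n))} (hA : SmoothMatOn A s)
    (hτ : ContDiffOn ℝ ∞ τ t) (hm : Set.MapsTo τ t s) : SmoothMatOn (fun z ↦ A (τ z)) t :=
  fun i j ↦ (hA i j).comp hτ hm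

theorem SmoothMatOn.differentiableAt (hA : SmoothMatOn A s) (hs : IsOpen s) (hy : y ∈ s)
    (i j : Fin n) : DifferentiableAt ℝ (fun z ↦ A z i j) y :=
  differentiableAt_of_contDiffOn hs (hA i j) hy

theorem mpderiv_mul (hs : IsOpen s) (hA : SmoothMatOn A s) (hB : SmoothMatOn B s) (hy : y ∈ s)
    (l : Fin n) :
    mpderiv l (fun z ↦ A z * B z) y = mpderiv l A y * B y + A y * mpderiv l B y := by
  ext i j
  have hA' := hA.differentiableAt hs hy
  have hB' := hB.differentiableAt hs hy
  simp only [mpderiv, Matrix.of_apply, Matrix.mul_apply, Matrix.add_apply]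
  rw [pderiv_sum (f := fun k z ↦ A z i k * B z k j) fun k _ ↦ (hA' i k).mul
    (hB' k j), ← Finset.sum_add_distrib]
  exact Finset.sum_congr rfl fun k _ ↦ pderiv_mul (hA' i k) (hB' k j) l

theorem mpderiv_add (hs : IsOpen s) (hA : SmoothMatOn A s) (hB : SmoothMatOn B s) (hy : y ∈ s)
    (l : Fin n) :
    mpderiv l (fun z ↦ A z + B z) y = mpderiv l A y + mpderiv l B y := by
  ext i j
  exact pderiv_add (hA.differentiableAt hs hy i j) (hB.differentiableAt hs hy i j) l

theorem mpderiv_sum {ι : Type*} {t : Finset ι}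
    {F : ι → EuclideanSpace ℝ (Fin n) → Matrix (Fin n) (Fin n) ℝ}
    (hs : IsOpen s) (hF : ∀ k, SmoothMatOn (F k) s) (hy : y ∈ s) (l : Fin n) :
    mpderiv l (fun z ↦ ∑ k ∈ t, F k z) y = ∑ k ∈ t, mpderiv l (F k) y := by
  ext i j
  simp only [mpderiv, Matrix.of_apply, Matrix.sum_apply]
  exact pderiv_sum (fun k _ ↦ (hF k).differentiableAt hs hy i j) l

theorem mpderiv_smul {f : EuclideanSpace ℝ (Fin n) → ℝ} (hs : IsOpen s) (hf : ContDiffOn ℝ ∞ f s)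
    (hA : SmoothMatOn A s) (hy : y ∈ s) (l : Fin n) :
    mpderiv l (fun z ↦ f z • A z) y = pderiv l f y • A y + f y • mpderiv l A y := by
  ext i j
  exact pderiv_mul (differentiableAt_of_contDiffOn hs hf hy) (hA.differentiableAt hs hy i j) l

theorem mpderiv_transpose (l : Fin n) :
    mpderiv l (fun z ↦ (A z).transpose) y = (mpderiv l A y).transpose := rfl

theorem mpderiv_congr (hs : IsOpen s) (h : ∀ z ∈ s, A z = B z) (hy : y ∈ s) (l : Fin n) :
    mpderiv l A y = mpderiv l B y := by
  ext i j
  exact pderiv_congr hs (fun z hz ↦ by rw [h z hz]) hy l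

theorem mpderiv_comp {τ : EuclideanSpace ℝ (Fin n) → EuclideanSpace ℝ (Fin n)} (hs : IsOpen s)
    (hA : SmoothMatOn A s) (hy : τ y ∈ s)
    (hτ : DifferentiableAt ℝ τ y) (l : Fin n) :
    mpderiv l (fun z ↦ A (τ z)) y = ∑ a, jacobi τ y a l • mpderiv a A (τ y) := by
  ext i j
  simp only [mpderiv, Matrix.of_apply, Matrix.sum_apply, Matrix.smul_apply, smul_eq_mul]
  exact pderiv_comp (hA.differentiableAt hs hy i j) hτ l

theorem mpderiv_comm (hs : IsOpen s) (hA : SmoothMatOn A s) (hy : y ∈ s) (k l : Fin n) :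
    mpderiv k (mpderiv l A) y = mpderiv l (mpderiv k A) y := by
  ext i j
  exact pderiv_comm hs (hA i j) hy k l

/-- Differentiate `A⁻¹ A = 1`. -/
theorem mpderiv_inv (hs : IsOpen s) (hA : SmoothMatOn A s) (hdet : ∀ z ∈ s, (A z).det ≠ 0)
    (hy : y ∈ s) (l : Fin n) :
    mpderiv l (fun z ↦ (A z)⁻¹) y = -((A y)⁻¹ * mpderiv l A y * (A y)⁻¹) := by
  have hu : ∀ z ∈ s, IsUnit (A z).det := fun z hz ↦ (hdet z hz).isUnit
  have h1 := mpderiv_mul hs (hA.inv hdet) hA hy l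
  have h2 : mpderiv l (fun z ↦ (A z)⁻¹ * A z) y = 0 := by
    rw [mpderiv_congr hs (B := fun _ ↦ 1) (fun z hz ↦ Matrix.nonsing_inv_mul _ (hu z hz)) hy]
    ext i j
    simp [mpderiv, pderiv]
  rw [h2] at h1
  have h3 : mpderiv l (fun z ↦ (A z)⁻¹) y * A y = -((A y)⁻¹ * mpderiv l A y) :=
    eq_neg_of_add_eq_zero_left h1.symm
  calc _ = mpderiv l (fun z ↦ (A z)⁻¹) y * A y * (A y)⁻¹ := by
        rw [Matrix.mul_assoc, Matrix.mul_nonsing_inv _ (hu y hy), Matrix.mul_one]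
    _ = _ := by rw [h3, neg_mul]

end SmoothMat

theorem SmoothMatOn.jacobi {τ : EuclideanSpace ℝ (Fin n) → EuclideanSpace ℝ (Fin n)}
    {t : Set (EuclideanSpace ℝ (Fin n))} (ht : IsOpen t) (hτ : ContDiffOn ℝ ∞ τ t) :
    SmoothMatOn (jacobi τ) t := fun a i ↦
  ContDiffOn.pderiv ht (((EuclideanSpace.proj (𝕜 := ℝ) a).contDiff.comp_contDiffOn hτ)) i

end Coordinates

/-! ### Coordinate invariance of the scalar curvature -/

section Curvature

variable {n : ℕ}

/-- `G` is a smooth field of nondegenerate symmetric matrices on the open set `s`. -/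
structure IsCoordMetricOn (G : EuclideanSpace ℝ (Fin n) → Matrix (Fin n) (Fin n) ℝ)
    (s : Set (EuclideanSpace ℝ (Fin n))) : Prop where
  isOpen : IsOpen s
  smooth : SmoothMatOn G s
  symm : ∀ y ∈ s, (G y).transpose = G y
  det_ne : ∀ y ∈ s, (G y).det ≠ 0

/-- The `i`-th connection matrix, with entries `Γᵏᵢⱼ` in row `k` and column `j`. -/
def connMat (G : EuclideanSpace ℝ (Fin n) → Matrix (Fin n) (Fin n) ℝ) (i : Fin n)
    (y : EuclideanSpace ℝ (Fin n)) : Matrix (Fin n) (Fin n) ℝ :=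
  Matrix.of fun k j ↦ christoffel G k i j y

/-- The Christoffel symbols of the first kind: entry `(l, j)` is
`½ (∂ᵢ Gⱼₗ + ∂ⱼ Gᵢₗ - ∂ₗ Gᵢⱼ)`. -/
def connMatLower (G : EuclideanSpace ℝ (Fin n) → Matrix (Fin n) (Fin n) ℝ) (i : Fin n)
    (y : EuclideanSpace ℝ (Fin n)) : Matrix (Fin n) (Fin n) ℝ :=
  Matrix.of fun l j ↦ (1 / 2 : ℝ) * (pderiv i (fun z ↦ G z j l) y +
    pderiv j (fun z ↦ G z i l) y - pderiv l (fun z ↦ G z i j) y)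

/-- The curvature matrix `∂ₗ Γⱼ - ∂ⱼ Γₗ + [Γₗ, Γⱼ]`. -/
def curvMat (G : EuclideanSpace ℝ (Fin n) → Matrix (Fin n) (Fin n) ℝ) (l j : Fin n)
    (y : EuclideanSpace ℝ (Fin n)) : Matrix (Fin n) (Fin n) ℝ :=
  mpderiv l (connMat G j) y - mpderiv j (connMat G l) y +
    (connMat G l y * connMat G j y - connMat G j y * connMat G l y)

theorem connMat_eq (G : EuclideanSpace ℝ (Fin n) → Matrix (Fin n) (Fin n) ℝ) (i : Fin n)
    (y : EuclideanSpace ℝ (Fin n)) : connMat G i y = (G y)⁻¹ * connMatLower G i y := by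
  ext k j
  simp only [connMat, christoffel, connMatLower, Matrix.mul_apply, Matrix.of_apply,
    Finset.mul_sum]
  exact Finset.sum_congr rfl fun l _ ↦ by ring

namespace IsCoordMetricOn

variable {G : EuclideanSpace ℝ (Fin n) → Matrix (Fin n) (Fin n) ℝ}
  {s : Set (EuclideanSpace ℝ (Fin n))} {y : EuclideanSpace ℝ (Fin n)}

theorem pderiv_symm (hG : IsCoordMetricOn G s) (hy : y ∈ s) (l i j : Fin n) :
    pderiv l (fun z ↦ G z i j) y = pderiv l (fun z ↦ G z j i) y :=
  pderiv_congr hG.isOpen (fun z hz ↦ by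
    conv_lhs => rw [← hG.symm z hz]
    rfl) hy l

theorem mul_connMat (hG : IsCoordMetricOn G s) (hy : y ∈ s) (i : Fin n) :
    G y * connMat G i y = connMatLower G i y := by
  rw [connMat_eq, Matrix.mul_nonsing_inv_cancel_left _ _ (hG.det_ne y hy).isUnit]

theorem christoffel_comm (hG : IsCoordMetricOn G s) (hy : y ∈ s) (k i j : Fin n) :
    christoffel G k i j y = christoffel G k j i y := by
  simp only [christoffel]
  congr 1
  refine Finset.sum_congr rfl fun l _ ↦ ?_
  rw [hG.pderiv_symm hy l i j]
  ring

/-- Compatibility of the Levi-Civita connection with the metric, `∇G = 0`, in matrix form. -/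
theorem mpderiv_eq (hG : IsCoordMetricOn G s) (hy : y ∈ s) (i : Fin n) :
    mpderiv i G y = G y * connMat G i y + (G y * connMat G i y).transpose := by
  rw [hG.mul_connMat hy]
  ext k j
  simp only [mpderiv, connMatLower, Matrix.of_apply, Matrix.add_apply, Matrix.transpose_apply]
  rw [hG.pderiv_symm hy i j k, hG.pderiv_symm hy k i j]
  ring

/-- Uniqueness of the Levi-Civita connection: the Koszul combination of the three compatibility
equations, together with the symmetry of the lower indices, recovers `G C i`. This replaces a direct
computation of transformed Christoffel symbols. -/
theorem eq_connMat (hG : IsCoordMetricOn G s) (hy : y ∈ s)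
    {C : Fin n → Matrix (Fin n) (Fin n) ℝ} (hC : ∀ i j k, C i k j = C j k i)
    (h : ∀ i, mpderiv i G y = G y * C i + (G y * C i).transpose) (i : Fin n) :
    C i = connMat G i y := by
  have hs : ∀ i j k, (G y * C i) k j = (G y * C j) k i := fun i j k ↦ by
    simp only [Matrix.mul_apply, hC i j]
  have hd : ∀ l a b, pderiv l (fun z ↦ G z a b) y = (G y * C l) a b + (G y * C l) b a :=
    fun l a b ↦ congrFun (congrFun (h l) a) b
  have key : G y * C i = connMatLower G i y := by
    ext l j
    simp only [connMatLower, Matrix.of_apply, hd]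
    rw [hs l j i, hs l i j, hs j i l]
    ring
  rw [connMat_eq, ← key, Matrix.nonsing_inv_mul_cancel_left _ _ (hG.det_ne y hy).isUnit]

theorem smooth_connMat (hG : IsCoordMetricOn G s) (i : Fin n) :
    SmoothMatOn (connMat G i) s := by
  have h : connMat G i = fun y ↦ (G y)⁻¹ * connMatLower G i y := funext (connMat_eq G i)
  rw [h]
  refine (hG.smooth.inv hG.det_ne).mul fun l j ↦ contDiffOn_const.mul ?_
  have hp := fun l a b ↦ ContDiffOn.pderiv hG.isOpen (hG.smooth a b) l
  exact ((hp i j l).add (hp j i l)).sub (hp l i j)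

/-- Ricci as a trace of the curvature matrices, after swapping the symmetric lower indices of the
Christoffel symbols. In this form it inherits the tensorial transformation law. -/
theorem ricci_eq (hG : IsCoordMetricOn G s) (hy : y ∈ s) (i j : Fin n) :
    ricci G i j y = ∑ k, curvMat G k j y k i := by
  have hp : ∀ m k a b, pderiv m (christoffel G k a b) y = pderiv m (christoffel G k b a) y :=
    fun m k a b ↦ pderiv_congr hG.isOpen (fun z hz ↦ hG.christoffel_comm hz k a b) hy m
  simp only [ricci, curvMat, mpderiv, connMat, Matrix.add_apply, Matrix.sub_apply,
    Matrix.of_apply, Matrix.mul_apply]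
  rw [← Finset.sum_add_distrib]
  refine Finset.sum_congr rfl fun k _ ↦ ?_
  rw [Finset.sum_sub_distrib]
  congr 1
  · congr 1
    · exact hp _ _ _ _
    · exact hp _ _ _ _
  · congr 1
    · exact Finset.sum_congr rfl fun l _ ↦ by rw [hG.christoffel_comm hy l i j]
    · exact Finset.sum_congr rfl fun l _ ↦ by rw [hG.christoffel_comm hy l i k]

theorem scalCoord_eq (hG : IsCoordMetricOn G s) (hy : y ∈ s) :
    scalCoord G y = ((G y)⁻¹ * (Matrix.of fun i j ↦ ricci G i j y)).trace := by
  have hinv : ((G y)⁻¹).transpose = (G y)⁻¹ := by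
    rw [Matrix.transpose_nonsing_inv, hG.symm y hy]
  simp only [scalCoord, Matrix.trace, Matrix.diag, Matrix.mul_apply, Matrix.of_apply]
  rw [Finset.sum_comm]
  refine Finset.sum_congr rfl fun j _ ↦ Finset.sum_congr rfl fun i _ ↦ ?_
  conv_lhs => rw [← hinv]
  rfl

end IsCoordMetricOn

/-- `H` is the pullback of the coordinate metric `G` under `τ`. -/
structure IsCoordPullback (G H : EuclideanSpace ℝ (Fin n) → Matrix (Fin n) (Fin n) ℝ)
    (s t : Set (EuclideanSpace ℝ (Fin n)))
    (τ : EuclideanSpace ℝ (Fin n) → EuclideanSpace ℝ (Fin n)) : Prop where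
  source : IsCoordMetricOn G s
  isOpen : IsOpen t
  smooth : ContDiffOn ℝ ∞ τ t
  mapsTo : Set.MapsTo τ t s
  jacobi_ne : ∀ y ∈ t, (jacobi τ y).det ≠ 0
  eq : ∀ y ∈ t, H y = (jacobi τ y).transpose * G (τ y) * jacobi τ y

namespace IsCoordPullback

variable {G H : EuclideanSpace ℝ (Fin n) → Matrix (Fin n) (Fin n) ℝ}
  {s t : Set (EuclideanSpace ℝ (Fin n))} {y : EuclideanSpace ℝ (Fin n)}
  {τ : EuclideanSpace ℝ (Fin n) → EuclideanSpace ℝ (Fin n)}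

theorem smoothMatOn (h : IsCoordPullback G H s t τ) : SmoothMatOn H t := fun i j ↦ by
  have hJ := SmoothMatOn.jacobi h.isOpen h.smooth
  refine (((hJ.transpose.mul (h.source.smooth.comp h.smooth h.mapsTo)).mul hJ) i j).congr ?_
  intro z hz
  simp only [h.eq z hz]

theorem isCoordMetricOn (h : IsCoordPullback G H s t τ) : IsCoordMetricOn H t where
  isOpen := h.isOpen
  smooth := h.smoothMatOn
  symm y hy := by
    rw [h.eq y hy]
    simp [Matrix.transpose_mul, h.source.symm _ (h.mapsTo hy), Matrix.mul_assoc]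
  det_ne y hy := by
    rw [h.eq y hy]
    simp [Matrix.det_mul, h.source.det_ne _ (h.mapsTo hy), h.jacobi_ne y hy]

theorem differentiableAt (h : IsCoordPullback G H s t τ) (hy : y ∈ t) :
    DifferentiableAt ℝ τ y :=
  (h.smooth.contDiffAt (h.isOpen.mem_nhds hy)).differentiableAt (by simp)

/-- The transformation law of the connection matrices. -/
theorem jacobi_mul_connMat (h : IsCoordPullback G H s t τ) (hy : y ∈ t) (i : Fin n) :
    jacobi τ y * connMat H i y =
      (∑ a, jacobi τ y a i • connMat G a (τ y)) * jacobi τ y + mpderiv i (jacobi τ) y := by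
  set J := jacobi τ y with hJdef
  set D : Fin n → Matrix (Fin n) (Fin n) ℝ :=
    fun i ↦ (∑ a, J a i • connMat G a (τ y)) * J + mpderiv i (jacobi τ) y with hD
  have hu : IsUnit J.det := (h.jacobi_ne y hy).isUnit
  have hJ := SmoothMatOn.jacobi h.isOpen h.smooth
  have hGτ := h.source.smooth.comp h.smooth h.mapsTo
  -- The first summand is symmetric because the connection of `G` is torsion free, the second
  -- because second derivatives of `τ` commute.
  have hDsymm : ∀ i j k, D i k j = D j k i := by
    intro i j k
    simp only [hD, Matrix.add_apply, Matrix.mul_apply, Matrix.sum_apply, Matrix.smul_apply,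
      smul_eq_mul]
    congr 1
    · simp only [Finset.sum_mul]
      rw [Finset.sum_comm]
      refine Finset.sum_congr rfl fun a _ ↦ Finset.sum_congr rfl fun b _ ↦ ?_
      simp only [connMat, Matrix.of_apply]
      rw [h.source.christoffel_comm (h.mapsTo hy) k a b]
      ring
    · exact pderiv_comm h.isOpen
        ((EuclideanSpace.proj (𝕜 := ℝ) k).contDiff.comp_contDiffOn h.smooth) hy i j
  have hJD : ∀ i, J * (J⁻¹ * D i) = D i := fun i ↦ Matrix.mul_nonsing_inv_cancel_left _ _ hu
  -- By uniqueness of the Levi-Civita connection it suffices that `J⁻¹ D` is symmetric and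
  -- compatible with `H`. Compatibility comes from differentiating `H = Jᵀ G(τ) J`.
  suffices hC : J⁻¹ * D i = connMat H i y by rw [← hC, hJD]
  refine h.isCoordMetricOn.eq_connMat hy (C := fun i ↦ J⁻¹ * D i) ?_ ?_ i
  · intro i j k
    simp only [Matrix.mul_apply, hDsymm i j]
  · intro i
    have hHC : H y * (J⁻¹ * D i) = J.transpose * G (τ y) * D i := by
      rw [h.eq y hy, Matrix.mul_assoc (J.transpose * G (τ y)), hJD]
    rw [hHC, mpderiv_congr h.isOpen h.eq hy,
      mpderiv_mul h.isOpen (hJ.transpose.mul hGτ) hJ hy, mpderiv_mul h.isOpen hJ.transpose hGτ hy,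
      mpderiv_transpose,
      mpderiv_comp h.source.isOpen h.source.smooth (h.mapsTo hy) (h.differentiableAt hy)]
    have e1 : ∑ a, J a i • mpderiv a G (τ y) =
        G (τ y) * (∑ a, J a i • connMat G a (τ y)) +
          (G (τ y) * (∑ a, J a i • connMat G a (τ y))).transpose := by
      rw [Finset.mul_sum, Matrix.transpose_sum, ← Finset.sum_add_distrib]
      refine Finset.sum_congr rfl fun a _ ↦ ?_
      rw [h.source.mpderiv_eq (h.mapsTo hy)]
      simp [smul_add]
    rw [e1]
    simp only [hD, Matrix.transpose_mul, Matrix.transpose_add, Matrix.transpose_transpose,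
      h.source.symm _ (h.mapsTo hy), ← hJdef]
    noncomm_ring

/-- Differentiate the law `J Γ_j = A_j J + ∂_j J` in direction `l` and antisymmetrize. The terms
with second and third derivatives of `τ` are symmetric in `l`, `j` or cancel against those produced
by the commutator, so only the tensorial part survives. -/
theorem jacobi_mul_curvMat (h : IsCoordPullback G H s t τ) (hy : y ∈ t) (l j : Fin n) :
    jacobi τ y * curvMat H l j y =
      (∑ d, ∑ b, (jacobi τ y d l * jacobi τ y b j) • curvMat G d b (τ y)) * jacobi τ y := by
  have hJ := SmoothMatOn.jacobi h.isOpen h.smooth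
  have hconn := h.isCoordMetricOn.smooth_connMat
  have hΓ : ∀ a, SmoothMatOn (fun z ↦ connMat G a (τ z)) t := fun a ↦
    (h.source.smooth_connMat a).comp h.smooth h.mapsTo
  have hJΓ : ∀ i a, SmoothMatOn (fun z ↦ jacobi τ z a i • connMat G a (τ z)) t :=
    fun i a ↦ SmoothMatOn.smul (hJ a i) (hΓ a)
  set J := jacobi τ y with hJdef
  set K : Fin n → Matrix (Fin n) (Fin n) ℝ := fun i ↦ mpderiv i (jacobi τ) y with hK
  set A : Fin n → Matrix (Fin n) (Fin n) ℝ := fun i ↦ ∑ a, J a i • connMat G a (τ y) with hA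
  have hlaw : ∀ i, J * connMat H i y = A i * J + K i := fun i ↦ h.jacobi_mul_connMat hy i
  -- the differentiated transformation law
  have hdiff : ∀ l i, K l * connMat H i y + J * mpderiv l (connMat H i) y =
      ((∑ a, mpderiv l (jacobi τ) y a i • connMat G a (τ y)) +
        ∑ a, ∑ d, (J d l * J a i) • mpderiv d (connMat G a) (τ y)) * J + A i * K l +
        mpderiv l (mpderiv i (jacobi τ)) y := by
    intro l i
    rw [← mpderiv_mul h.isOpen hJ (hconn i) hy,
      mpderiv_congr h.isOpen (fun z hz ↦ h.jacobi_mul_connMat hz i) hy,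
      mpderiv_add h.isOpen ((SmoothMatOn.sum (hJΓ i)).mul hJ) (hJ.mpderiv h.isOpen i) hy,
      mpderiv_mul h.isOpen (SmoothMatOn.sum (hJΓ i)) hJ hy,
      mpderiv_sum h.isOpen (hJΓ i) hy]
    congr 3
    rw [← Finset.sum_add_distrib]
    refine Finset.sum_congr rfl fun a _ ↦ ?_
    rw [mpderiv_smul h.isOpen (hJ a i) (hΓ a) hy, mpderiv_comp h.source.isOpen
      (h.source.smooth_connMat a) (h.mapsTo hy) (h.differentiableAt hy), Finset.smul_sum]
    congr 1
    refine Finset.sum_congr rfl fun d _ ↦ ?_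
    rw [smul_smul, mul_comm]
  have hsymmK : ∀ l i, ∑ a, mpderiv l (jacobi τ) y a i • connMat G a (τ y) =
      ∑ a, mpderiv i (jacobi τ) y a l • connMat G a (τ y) := by
    intro l i
    refine Finset.sum_congr rfl fun a _ ↦ ?_
    congr 1
    exact pderiv_comm h.isOpen
        ((EuclideanSpace.proj (𝕜 := ℝ) a).contDiff.comp_contDiffOn h.smooth) hy l i
  have hsymm3 := mpderiv_comm h.isOpen hJ hy l j
  have hprod : ∀ l j, J * (connMat H l y * connMat H j y) =
      A l * A j * J + A l * K j + K l * connMat H j y := by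
    intro l j
    rw [← Matrix.mul_assoc, hlaw, Matrix.add_mul, Matrix.mul_assoc (A l), hlaw, Matrix.mul_add,
      Matrix.mul_assoc]
  have hR : ∑ d, ∑ b, (J d l * J b j) • curvMat G d b (τ y) =
      (∑ a, ∑ d, (J d l * J a j) • mpderiv d (connMat G a) (τ y)) -
      (∑ a, ∑ d, (J d j * J a l) • mpderiv d (connMat G a) (τ y)) + (A l * A j - A j * A l) := by
    simp only [curvMat, smul_add, smul_sub, Finset.sum_add_distrib, Finset.sum_sub_distrib, hA,
      Finset.sum_mul_sum]
    congr 1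
    · congr 1
      · exact Finset.sum_comm
      · exact Finset.sum_congr rfl fun d _ ↦ Finset.sum_congr rfl fun b _ ↦ by rw [mul_comm]
    · congr 1
      · refine Finset.sum_congr rfl fun d _ ↦ Finset.sum_congr rfl fun b _ ↦ ?_
        rw [smul_mul_smul_comm]
      · rw [Finset.sum_comm]
        refine Finset.sum_congr rfl fun d _ ↦ Finset.sum_congr rfl fun b _ ↦ ?_
        rw [smul_mul_smul_comm, mul_comm (J b l)]
  rw [hR]
  have e1 := hdiff l j
  have e2 := hdiff j l
  rw [hsymmK j l, ← hsymm3] at e2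
  simp only [curvMat, Matrix.mul_add, Matrix.mul_sub, hprod]
  rw [← eq_sub_iff_add_eq'] at e1 e2
  rw [e1, e2]
  noncomm_ring

theorem ricci_eq (h : IsCoordPullback G H s t τ) (hy : y ∈ t) :
    (Matrix.of fun i j ↦ ricci H i j y) =
      (jacobi τ y).transpose * (Matrix.of fun i j ↦ ricci G i j (τ y)) * jacobi τ y := by
  have hu : IsUnit (jacobi τ y).det := (h.jacobi_ne y hy).isUnit
  ext i j
  set J := jacobi τ y with hJdef
  have hcurv : ∀ k, curvMat H k j y k i =
      ∑ d, ∑ b, ∑ c, ∑ a, J⁻¹ k c * J d k * J b j * (curvMat G d b (τ y) c a * J a i) := by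
    intro k
    have : curvMat H k j y = J⁻¹ *
        ((∑ d, ∑ b, (J d k * J b j) • curvMat G d b (τ y)) * J) := by
      rw [← h.jacobi_mul_curvMat hy, Matrix.nonsing_inv_mul_cancel_left _ _ hu]
    rw [this]
    simp only [Finset.sum_mul, Finset.mul_sum, Matrix.sum_apply]
    refine Finset.sum_congr rfl fun d _ ↦ Finset.sum_congr rfl fun b _ ↦ ?_
    simp only [Matrix.mul_apply, Matrix.smul_apply, smul_eq_mul, Finset.mul_sum]
    refine Finset.sum_congr rfl fun c _ ↦ Finset.sum_congr rfl fun a _ ↦ by ring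
  -- Contracting the upper index with the direction of differentiation pairs `J⁻¹` with `J`, which
  -- leaves two factors `J` for the two free indices.
  have hdelta : ∀ d c, ∑ k, J⁻¹ k c * J d k = if d = c then 1 else 0 := by
    intro d c
    have := congrFun (congrFun (Matrix.mul_nonsing_inv J hu) d) c
    rw [Matrix.mul_apply, Matrix.one_apply] at this
    rw [← this]
    exact Finset.sum_congr rfl fun k _ ↦ mul_comm _ _
  simp only [Matrix.of_apply]
  rw [h.isCoordMetricOn.ricci_eq hy]
  simp only [hcurv]
  calc _ = ∑ d, ∑ b, ∑ c, ∑ a, (∑ k, J⁻¹ k c * J d k) *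
        (J b j * (curvMat G d b (τ y) c a * J a i)) := by
        rw [Finset.sum_comm]
        refine Finset.sum_congr rfl fun d _ ↦ ?_
        rw [Finset.sum_comm]
        refine Finset.sum_congr rfl fun b _ ↦ ?_
        rw [Finset.sum_comm]
        refine Finset.sum_congr rfl fun c _ ↦ ?_
        rw [Finset.sum_comm]
        refine Finset.sum_congr rfl fun a _ ↦ ?_
        rw [Finset.sum_mul]
        exact Finset.sum_congr rfl fun k _ ↦ by ring
    _ = ∑ d, ∑ b, ∑ a, J b j * (curvMat G d b (τ y) d a * J a i) := by
        refine Finset.sum_congr rfl fun d _ ↦ Finset.sum_congr rfl fun b _ ↦ ?_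
        rw [Finset.sum_eq_single d]
        · simp [hdelta]
        · intro c _ hc
          simp [hdelta, hc.symm]
        · simp
    _ = _ := by
        simp only [Matrix.mul_apply, Matrix.of_apply, Matrix.transpose_apply, Finset.sum_mul]
        rw [Finset.sum_comm]
        refine Finset.sum_congr rfl fun b _ ↦ ?_
        rw [Finset.sum_comm]
        refine Finset.sum_congr rfl fun a _ ↦ ?_
        rw [h.source.ricci_eq (h.mapsTo hy), Finset.mul_sum, Finset.sum_mul]
        exact Finset.sum_congr rfl fun d _ ↦ by ring

/-- The scalar curvature does not depend on the choice of coordinates. -/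
theorem scalCoord_eq (h : IsCoordPullback G H s t τ) (hy : y ∈ t) :
    scalCoord H y = scalCoord G (τ y) := by
  have hu : IsUnit (jacobi τ y).det := (h.jacobi_ne y hy).isUnit
  have hut : IsUnit (jacobi τ y).transpose.det := by rwa [Matrix.det_transpose]
  rw [h.isCoordMetricOn.scalCoord_eq hy, h.source.scalCoord_eq (h.mapsTo hy), h.ricci_eq hy,
    h.eq y hy, Matrix.mul_inv_rev, Matrix.mul_inv_rev]
  rw [Matrix.mul_assoc (jacobi τ y).transpose, Matrix.mul_assoc (jacobi τ y)⁻¹,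
    Matrix.mul_assoc (G (τ y))⁻¹, Matrix.nonsing_inv_mul_cancel_left _ _ hut, Matrix.trace_mul_comm,
    Matrix.mul_assoc, Matrix.mul_assoc, Matrix.mul_nonsing_inv _ hu, Matrix.mul_one]

end IsCoordPullback

end Curvature

/-! ### Metric coefficients in charts -/

section MetricCoeff

variable {n : ℕ} {M : Type*} [TopologicalSpace M] [ChartedSpace (EuclideanSpace ℝ (Fin n)) M]
  [IsManifold (𝓡 n) ∞ M]

/-- The pullback of the metric `g` under the map `f`, as a bilinear form on `ℝⁿ`. -/
def pullbackForm (g : Metr n M) (f : EuclideanSpace ℝ (Fin n) → M)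
    (y v w : EuclideanSpace ℝ (Fin n)) : ℝ :=
  g.inner (f y) (mfderiv (𝓡 n) (𝓡 n) f y v) (mfderiv (𝓡 n) (𝓡 n) f y w)

theorem inner_congr (g : Metr n M) {x x' : M} (h : x = x') (a b : EuclideanSpace ℝ (Fin n)) :
    g.inner x (show TangentSpace (𝓡 n) x from a) (show TangentSpace (𝓡 n) x from b) =
      g.inner x' (show TangentSpace (𝓡 n) x' from a) (show TangentSpace (𝓡 n) x' from b) := by
  subst h; rfl

theorem pullbackForm_congr (g : Metr n M) {f f' : EuclideanSpace ℝ (Fin n) → M}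
    {y : EuclideanSpace ℝ (Fin n)} (h : f =ᶠ[𝓝 y] f') (v w : EuclideanSpace ℝ (Fin n)) :
    pullbackForm g f y v w = pullbackForm g f' y v w := by
  have hd : ∀ u : EuclideanSpace ℝ (Fin n),
      (mfderiv (𝓡 n) (𝓡 n) f y u : EuclideanSpace ℝ (Fin n)) = mfderiv (𝓡 n) (𝓡 n) f' y u :=
    fun u ↦ congrArg (fun L : EuclideanSpace ℝ (Fin n) →L[ℝ] EuclideanSpace ℝ (Fin n) ↦ L u)
      h.mfderiv_eq
  refine (inner_congr g h.self_of_nhds _ _).trans ?_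
  rw [hd v, hd w]
  rfl

theorem pullbackForm_comp (g : Metr n M) {f : EuclideanSpace ℝ (Fin n) → M}
    {τ : EuclideanSpace ℝ (Fin n) → EuclideanSpace ℝ (Fin n)}
    {y : EuclideanSpace ℝ (Fin n)} (hf : MDifferentiableAt (𝓡 n) (𝓡 n) f (τ y))
    (hτ : DifferentiableAt ℝ τ y) (v w : EuclideanSpace ℝ (Fin n)) :
    pullbackForm g (f ∘ τ) y v w = pullbackForm g f (τ y) (fderiv ℝ τ y v) (fderiv ℝ τ y w) := by
  simp only [pullbackForm]
  rw [mfderiv_comp y hf hτ.mdifferentiableAt, mfderiv_eq_fderiv]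
  rfl

theorem pullbackForm_eq_sum (g : Metr n M) (f : EuclideanSpace ℝ (Fin n) → M)
    (y v w : EuclideanSpace ℝ (Fin n)) :
    pullbackForm g f y v w = ∑ a, ∑ b, v a * w b *
      pullbackForm g f y (EuclideanSpace.single a 1) (EuclideanSpace.single b 1) := by
  let L : EuclideanSpace ℝ (Fin n) →L[ℝ] TangentSpace (𝓡 n) (f y) := mfderiv (𝓡 n) (𝓡 n) f y
  have h1 : ∀ u : EuclideanSpace ℝ (Fin n), L u = ∑ a, u a • L (EuclideanSpace.single a 1) :=
    fun u ↦ by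
      conv_lhs => rw [single_eq_basis_sum u, map_sum]
      simp only [map_smul]
  change g.inner (f y) (L v) (L w) = ∑ a, ∑ b, v a * w b * g.inner (f y)
    (L (EuclideanSpace.single a 1)) (L (EuclideanSpace.single b 1))
  rw [h1 v, h1 w]
  simp only [map_sum, map_smul, sum_apply, smul_apply,
    smul_eq_mul, Finset.mul_sum]
  rw [Finset.sum_comm]
  exact Finset.sum_congr rfl fun a _ ↦ Finset.sum_congr rfl fun b _ ↦ by ring

variable {e e' : OpenPartialHomeomorph M (EuclideanSpace ℝ (Fin n))}

theorem metricCoeff_apply (g : Metr n M) (y : EuclideanSpace ℝ (Fin n)) (i j : Fin n) :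
    metricCoeff e g y i j =
      pullbackForm g e.symm y (EuclideanSpace.single i 1) (EuclideanSpace.single j 1) := rfl

theorem contMDiffOn_atlas (he : e ∈ atlas (EuclideanSpace ℝ (Fin n)) M) :
    ContMDiffOn (𝓡 n) (𝓡 n) ∞ e e.source :=
  contMDiffOn_of_mem_maximalAtlas (IsManifold.subset_maximalAtlas he)

theorem contMDiffOn_atlas_symm (he : e ∈ atlas (EuclideanSpace ℝ (Fin n)) M) :
    ContMDiffOn (𝓡 n) (𝓡 n) ∞ e.symm e.target :=
  contMDiffOn_symm_of_mem_maximalAtlas (IsManifold.subset_maximalAtlas he)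

theorem mdifferentiable_atlas (he : e ∈ atlas (EuclideanSpace ℝ (Fin n)) M) :
    e.MDifferentiable (𝓡 n) (𝓡 n) :=
  have : IsManifold (𝓡 n) 1 M := IsManifold.of_le (n := ∞) (by simp)
  mdifferentiable_of_mem_atlas he

theorem metricCoeff_smooth (he : e ∈ atlas (EuclideanSpace ℝ (Fin n)) M) (g : Metr n M) :
    SmoothMatOn (metricCoeff e g) e.target := by
  have hsymm := contMDiffOn_atlas_symm he
  have hT := hsymm.contMDiffOn_tangentMapWithin (m := ∞) le_rfl e.open_target.uniqueMDiffOn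
  have hvec : ∀ v : EuclideanSpace ℝ (Fin n), ContMDiffOn (𝓡 n) (𝓡 n).tangent ∞
      (fun y ↦ TotalSpace.mk' (EuclideanSpace ℝ (Fin n)) (E := fun x : M ↦ TangentSpace (𝓡 n) x)
        (e.symm y) (mfderiv (𝓡 n) (𝓡 n) e.symm y v)) e.target := by
    intro v
    -- The coordinate fields on `M` are images of constant sections of the tangent bundle of `ℝⁿ`
    -- under the tangent map of the inverse chart.
    have hc : ContMDiff (𝓡 n) (𝓡 n).tangent ∞ (fun y : EuclideanSpace ℝ (Fin n) ↦
        (⟨y, v⟩ : TangentBundle (𝓡 n) (EuclideanSpace ℝ (Fin n)))) :=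
      (contMDiff_vectorSpace_iff_contDiff (V := fun _ : EuclideanSpace ℝ (Fin n) ↦ v)).2
        contDiff_const
    refine (hT.comp hc.contMDiffOn (s := e.target) fun y hy ↦ hy).congr fun y hy ↦ ?_
    simp only [Function.comp, tangentMapWithin, mfderivWithin_of_isOpen e.open_target hy]
  intro i j
  rw [← contMDiffOn_iff_contDiffOn]
  intro y hy
  have : ContMDiffWithinAt (𝓡 n) ((𝓡 n).prod 𝓘(ℝ)) ∞
      (fun m ↦ TotalSpace.mk' ℝ (E := Bundle.Trivial M ℝ) (e.symm m)
        (metricCoeff e g m i j)) e.target y := by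
    refine ContMDiffWithinAt.clm_bundle_apply₂ (F₁ := EuclideanSpace ℝ (Fin n))
      (F₂ := EuclideanSpace ℝ (Fin n)) ?_ (hvec _ y hy) (hvec _ y hy)
    exact g.contMDiff.contMDiffAt.comp_contMDiffWithinAt y (hsymm y hy)
  simp only [contMDiffWithinAt_totalSpace] at this
  exact this.2

theorem metricCoeff_transpose (g : Metr n M) (y : EuclideanSpace ℝ (Fin n)) :
    (metricCoeff e g y).transpose = metricCoeff e g y := by
  ext i j
  exact g.symm _ _ _

theorem pullbackForm_self_pos (he : e ∈ atlas (EuclideanSpace ℝ (Fin n)) M) (g : Metr n M)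
    {y : EuclideanSpace ℝ (Fin n)} (hy : y ∈ e.target) {v : EuclideanSpace ℝ (Fin n)}
    (hv : v ≠ 0) : 0 < pullbackForm g e.symm y v v := by
  refine g.pos _ _ fun h ↦ hv ?_
  have := (mdifferentiable_atlas he).symm.mfderiv_injective hy
  exact this (h.trans (map_zero _).symm)

theorem metricCoeff_posDef (he : e ∈ atlas (EuclideanSpace ℝ (Fin n)) M) (g : Metr n M)
    {y : EuclideanSpace ℝ (Fin n)} (hy : y ∈ e.target) : (metricCoeff e g y).PosDef := by
  refine Matrix.PosDef.of_dotProduct_mulVec_pos ?_ fun v hv ↦ ?_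
  · rw [Matrix.IsHermitian, Matrix.conjTranspose_eq_transpose_of_trivial, metricCoeff_transpose]
  · have h := pullbackForm_self_pos he g hy (v := WithLp.toLp 2 v) (by simpa using hv)
    rw [pullbackForm_eq_sum] at h
    refine h.trans_eq (Eq.symm ?_)
    simp only [dotProduct, Matrix.mulVec, Finset.mul_sum, Pi.star_apply, star_trivial]
    exact Finset.sum_congr rfl fun a _ ↦ Finset.sum_congr rfl fun b _ ↦ by
      rw [metricCoeff_apply]; ring

theorem metricCoeff_det_pos (he : e ∈ atlas (EuclideanSpace ℝ (Fin n)) M) (g : Metr n M)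
    {y : EuclideanSpace ℝ (Fin n)} (hy : y ∈ e.target) : 0 < (metricCoeff e g y).det :=
  (metricCoeff_posDef he g hy).det_pos

theorem metricCoeff_isCoordMetricOn (he : e ∈ atlas (EuclideanSpace ℝ (Fin n)) M)
    (g : Metr n M) : IsCoordMetricOn (metricCoeff e g) e.target where
  isOpen := e.open_target
  smooth := metricCoeff_smooth he g
  symm y _ := metricCoeff_transpose g y
  det_ne _ hy := (metricCoeff_det_pos he g hy).ne'

/-- The domain of the coordinate change from `e'` to `e`. -/
def transDomain (e e' : OpenPartialHomeomorph M (EuclideanSpace ℝ (Fin n))) :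
    Set (EuclideanSpace ℝ (Fin n)) := e'.target ∩ e'.symm ⁻¹' e.source

theorem isOpen_transDomain : IsOpen (transDomain e e') :=
  e'.symm.isOpen_inter_preimage e.open_source

theorem contDiffOn_trans (he : e ∈ atlas (EuclideanSpace ℝ (Fin n)) M)
    (he' : e' ∈ atlas (EuclideanSpace ℝ (Fin n)) M) :
    ContDiffOn ℝ ∞ (e ∘ e'.symm) (transDomain e e') := by
  rw [← contMDiffOn_iff_contDiffOn]
  exact (contMDiffOn_atlas he).comp ((contMDiffOn_atlas_symm he').mono Set.inter_subset_left)
    fun y hy ↦ hy.2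

/-- Near each point of the overlap `e'.symm = e.symm ∘ (e ∘ e'.symm)`, so the chain rule gives `G' =
Jᵀ G J`. The Jacobian is invertible because `det G'` is positive. -/
theorem metricCoeff_isCoordPullback (he : e ∈ atlas (EuclideanSpace ℝ (Fin n)) M)
    (he' : e' ∈ atlas (EuclideanSpace ℝ (Fin n)) M) (g : Metr n M) :
    IsCoordPullback (metricCoeff e g) (metricCoeff e' g) e.target (transDomain e e')
      (e ∘ e'.symm) := by
  have hsmooth := contDiffOn_trans he he'
  have hmaps : Set.MapsTo (e ∘ e'.symm) (transDomain e e') e.target :=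
    fun y hy ↦ e.map_source hy.2
  have heq : ∀ y ∈ transDomain e e', metricCoeff e' g y =
      (jacobi (e ∘ e'.symm) y).transpose * metricCoeff e g ((e ∘ e'.symm) y) *
        jacobi (e ∘ e'.symm) y := by
    intro y hy
    have hd : DifferentiableAt ℝ (e ∘ e'.symm) y :=
      (hsmooth.contDiffAt (isOpen_transDomain.mem_nhds hy)).differentiableAt (by simp)
    have hev : e'.symm =ᶠ[𝓝 y] e.symm ∘ (e ∘ e'.symm) := by
      filter_upwards [isOpen_transDomain.mem_nhds hy] with z hz
      exact (e.left_inv hz.2).symm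
    ext i j
    rw [metricCoeff_apply, pullbackForm_congr g hev, pullbackForm_comp g
      ((mdifferentiable_atlas he).mdifferentiableAt_symm (hmaps hy)) hd, pullbackForm_eq_sum]
    simp only [fderiv_apply_eq_jacobi hd, Matrix.mul_apply, Matrix.transpose_apply,
      Finset.sum_mul, ← metricCoeff_apply]
    rw [Finset.sum_comm]
    exact Finset.sum_congr rfl fun a _ ↦ Finset.sum_congr rfl fun b _ ↦ by ring
  refine ⟨metricCoeff_isCoordMetricOn he g, isOpen_transDomain, hsmooth, hmaps, ?_, heq⟩
  intro y hy h0
  have h1 := (metricCoeff_det_pos he' g hy.1).ne'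
  rw [heq y hy] at h1
  simp [Matrix.det_mul, h0] at h1

theorem scal_eq (he : e ∈ atlas (EuclideanSpace ℝ (Fin n)) M) (g : Metr n M) {x : M}
    (hx : x ∈ e.source) : scal g x = scalCoord (metricCoeff e g) (e x) := by
  set c := chartAt (EuclideanSpace ℝ (Fin n)) x
  have hxc : x ∈ c.source := mem_chart_source _ x
  have hy : c x ∈ transDomain e c :=
    ⟨c.map_source hxc, by rwa [Set.mem_preimage, c.left_inv hxc]⟩
  have := (metricCoeff_isCoordPullback he (chart_mem_atlas _ x) g).scalCoord_eq hy
  rw [Function.comp, c.left_inv hxc] at this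
  exact this

end MetricCoeff

/-! ### The dual norm of a positive definite quadratic form -/

section DualNorm

variable {E : Type*} [NormedAddCommGroup E] [NormedSpace ℝ E] [FiniteDimensional ℝ E]

/-- `Q` has the properties of a positive definite quadratic form that bound its dual norm. -/
structure IsPosQuad (Q : E → ℝ) : Prop where
  continuous : Continuous Q
  smul : ∀ (c : ℝ) (v : E), Q (c • v) = c ^ 2 * Q v
  pos : ∀ v, v ≠ 0 → 0 < Q v

/-- The square of the norm of the linear form `α` that is dual to the norm `√Q`. -/
def dualNormSq (Q : E → ℝ) (α : E →L[ℝ] ℝ) : ℝ :=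
  sSup {r : ℝ | ∃ X, Q X ≤ 1 ∧ r = α X ^ 2}

variable {Q : E → ℝ} {α : E →L[ℝ] ℝ}

theorem isPosQuad_of_bilin (B : E →L[ℝ] E →L[ℝ] ℝ) (hB : ∀ v, v ≠ 0 → 0 < B v v) :
    IsPosQuad fun v ↦ B v v where
  continuous := B.continuous.clm_apply continuous_id
  smul c v := by
    simp
    ring
  pos := hB

theorem IsPosQuad.zero (hQ : IsPosQuad Q) : Q 0 = 0 := by
  simpa using hQ.smul 0 0

theorem IsPosQuad.nonneg (hQ : IsPosQuad Q) (v : E) : 0 ≤ Q v := by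
  rcases eq_or_ne v 0 with rfl | h
  · exact hQ.zero.ge
  · exact (hQ.pos v h).le

theorem IsPosQuad.ratio_smul (hQ : IsPosQuad Q) {c : ℝ} (hc : c ≠ 0) (v : E) :
    α (c • v) ^ 2 / Q (c • v) = α v ^ 2 / Q v := by
  rw [hQ.smul, map_smul, smul_eq_mul, mul_pow, mul_div_mul_left _ _ (pow_ne_zero 2 hc)]

theorem IsPosQuad.continuousOn_ratio (hQ : IsPosQuad Q) :
    ContinuousOn (fun v ↦ α v ^ 2 / Q v) (Metric.sphere 0 1) :=
  ((α.continuous.pow 2).continuousOn).div hQ.continuous.continuousOn fun v hv ↦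
    (hQ.pos v (ne_zero_of_mem_unit_sphere ⟨v, hv⟩)).ne'

theorem IsPosQuad.exists_bound (hQ : IsPosQuad Q) (α : E →L[ℝ] ℝ) :
    ∃ C, 0 ≤ C ∧ ∀ X, α X ^ 2 ≤ C * Q X := by
  obtain ⟨C, hC⟩ := ((isCompact_sphere (0 : E) 1).image_of_continuousOn
    (hQ.continuousOn_ratio (α := α))).bddAbove
  refine ⟨max C 0, le_max_right _ _, fun X ↦ ?_⟩
  rcases eq_or_ne X 0 with rfl | h
  · simp [hQ.zero]
  · rw [← div_le_iff₀ (hQ.pos X h), ← hQ.ratio_smul (inv_ne_zero (norm_ne_zero_iff.2 h))]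
    refine (hC ⟨_, ?_, rfl⟩).trans (le_max_left _ _)
    simp [norm_smul, h]

/-- Without this bound the supremum in `dualNormSq` would be the default value `0`. -/
theorem IsPosQuad.bddAbove (hQ : IsPosQuad Q) (α : E →L[ℝ] ℝ) :
    BddAbove {r : ℝ | ∃ X, Q X ≤ 1 ∧ r = α X ^ 2} := by
  obtain ⟨C, hC0, hC⟩ := hQ.exists_bound α
  refine ⟨C, ?_⟩
  rintro _ ⟨X, hX, rfl⟩
  exact (hC X).trans (mul_le_of_le_one_right hC0 hX)

theorem dualNormSq_nonneg : 0 ≤ dualNormSq Q α := by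
  refine Real.sSup_nonneg ?_
  rintro _ ⟨X, -, rfl⟩
  positivity

theorem IsPosQuad.sq_le (hQ : IsPosQuad Q) (X : E) : α X ^ 2 ≤ dualNormSq Q α * Q X := by
  rcases eq_or_ne X 0 with rfl | h
  · simp [hQ.zero]
  · have hpos := hQ.pos X h
    rw [← div_le_iff₀ hpos]
    have hc : (√(Q X))⁻¹ ≠ 0 := inv_ne_zero (Real.sqrt_pos.2 hpos).ne'
    have h1 : Q ((√(Q X))⁻¹ • X) = 1 := by
      rw [hQ.smul, inv_pow, Real.sq_sqrt hpos.le, inv_mul_cancel₀ hpos.ne']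
    rw [← hQ.ratio_smul hc, h1, div_one]
    exact le_csSup (hQ.bddAbove α) ⟨_, h1.le, rfl⟩

theorem dualNormSq_le {C : ℝ} (hC : 0 ≤ C) (h : ∀ X, α X ^ 2 ≤ C * Q X) :
    dualNormSq Q α ≤ C := by
  refine Real.sSup_le ?_ hC
  rintro _ ⟨X, hX, rfl⟩
  exact (h X).trans (mul_le_of_le_one_right hC hX)

/-- The ratio `α² / Q` is homogeneous of degree zero. The supremum is thus taken over a compact set
that does not depend on `Q`, as continuity in parameters requires. -/
theorem IsPosQuad.dualNormSq_eq [Nontrivial E] (hQ : IsPosQuad Q) :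
    dualNormSq Q α = sSup ((fun v ↦ α v ^ 2 / Q v) '' Metric.sphere 0 1) := by
  have hb := ((isCompact_sphere (0 : E) 1).image_of_continuousOn
    (hQ.continuousOn_ratio (α := α))).bddAbove
  refine le_antisymm ?_ ?_
  · refine dualNormSq_le ?_ fun X ↦ ?_
    · refine Real.sSup_nonneg ?_
      rintro _ ⟨X, -, rfl⟩
      exact div_nonneg (sq_nonneg _) (hQ.nonneg _)
    · rcases eq_or_ne X 0 with rfl | h
      · simp [hQ.zero]
      · rw [← div_le_iff₀ (hQ.pos X h), ← hQ.ratio_smul (inv_ne_zero (norm_ne_zero_iff.2 h))]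
        refine le_csSup hb ⟨_, ?_, rfl⟩
        simp [norm_smul, h]
  · refine csSup_le ((NormedSpace.sphere_nonempty.2 zero_le_one).image _) ?_
    rintro _ ⟨X, hX, rfl⟩
    exact (div_le_iff₀ (hQ.pos X (ne_zero_of_mem_unit_sphere ⟨X, hX⟩))).2 (hQ.sq_le X)

theorem continuousOn_dualNormSq [Nontrivial E] {Y : Type*} [TopologicalSpace Y] {s : Set Y}
    {Q : Y → E → ℝ} {α : Y → E →L[ℝ] ℝ} (hQ : ∀ y ∈ s, IsPosQuad (Q y))
    (hQc : ContinuousOn (fun q : Y × E ↦ Q q.1 q.2) (s ×ˢ Set.univ)) (hα : ContinuousOn α s) :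
    ContinuousOn (fun y ↦ dualNormSq (Q y) (α y)) s := by
  rw [continuousOn_iff_continuous_domRestrict]
  have heq : s.domRestrict (fun y ↦ dualNormSq (Q y) (α y)) = fun y : s ↦
      sSup ((fun v : Metric.sphere (0 : E) 1 ↦ α y v ^ 2 / Q y v) '' Set.univ) := by
    funext y
    rw [Set.domRestrict_apply, (hQ y y.2).dualNormSq_eq]
    congr 1
    ext r
    simp
  rw [heq]
  have : CompactSpace (Metric.sphere (0 : E) 1) := isCompact_iff_compactSpace.1
    (isCompact_sphere _ _)
  refine isCompact_univ.continuous_sSup ?_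
  have h1 : Continuous fun q : s × Metric.sphere (0 : E) 1 ↦ α q.1 q.2 :=
    ((continuousOn_iff_continuous_domRestrict.1 hα).comp continuous_fst).clm_apply
      (continuous_subtype_val.comp continuous_snd)
  have h2 : Continuous fun q : s × Metric.sphere (0 : E) 1 ↦ Q q.1 q.2 :=
    hQc.comp_continuous (f := fun q : s × Metric.sphere (0 : E) 1 ↦ ((q.1 : Y), (q.2 : E)))
      (by fun_prop) fun q ↦ ⟨q.1.2, trivial⟩
  exact (h1.pow 2).div h2 fun q ↦ ((hQ q.1 q.1.2).pos _ (ne_zero_of_mem_unit_sphere q.2)).ne'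

end DualNorm

/-! ### The squared norm of a differential -/

section NormSqDiff

variable {n : ℕ} {M : Type*} [TopologicalSpace M] [ChartedSpace (EuclideanSpace ℝ (Fin n)) M]
  [IsManifold (𝓡 n) ∞ M] {e : OpenPartialHomeomorph M (EuclideanSpace ℝ (Fin n))}

theorem isPosQuad_inner (g : Metr n M) (x : M) :
    IsPosQuad (E := EuclideanSpace ℝ (Fin n)) fun v ↦ g.inner x v v :=
  isPosQuad_of_bilin (E := EuclideanSpace ℝ (Fin n)) (g.inner x) fun v hv ↦ g.pos x v hv

theorem normSqDiff_eq (g : Metr n M) (v : M → ℝ) (x : M) :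
    normSqDiff g v x = dualNormSq (E := EuclideanSpace ℝ (Fin n)) (fun X ↦ g.inner x X X)
      (mfderiv (𝓡 n) 𝓘(ℝ, ℝ) v x) := rfl

theorem normSqDiff_nonneg (g : Metr n M) (v : M → ℝ) (x : M) : 0 ≤ normSqDiff g v x := by
  rw [normSqDiff_eq]
  exact dualNormSq_nonneg

/-- The differential of a function, as a linear form on `ℝⁿ`. -/
def diffForm (v : M → ℝ) (x : M) : EuclideanSpace ℝ (Fin n) →L[ℝ] ℝ :=
  mfderiv (𝓡 n) 𝓘(ℝ, ℝ) v x

theorem diffForm_sq_le (g : Metr n M) (v : M → ℝ) (x : M) (X : EuclideanSpace ℝ (Fin n)) :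
    diffForm v x X ^ 2 ≤ normSqDiff g v x * g.inner x X X :=
  (isPosQuad_inner g x).sq_le X

theorem normSqDiff_le (g : Metr n M) (v : M → ℝ) (x : M) {C : ℝ} (hC : 0 ≤ C)
    (h : ∀ X : EuclideanSpace ℝ (Fin n), diffForm v x X ^ 2 ≤ C * g.inner x X X) :
    normSqDiff g v x ≤ C :=
  dualNormSq_le (E := EuclideanSpace ℝ (Fin n)) hC h

theorem isPosQuad_pullbackForm (he : e ∈ atlas (EuclideanSpace ℝ (Fin n)) M) (g : Metr n M)
    {y : EuclideanSpace ℝ (Fin n)} (hy : y ∈ e.target) :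
    IsPosQuad fun v ↦ pullbackForm g e.symm y v v where
  continuous := by
    rw [funext fun v ↦ pullbackForm_eq_sum g e.symm y v v]
    fun_prop
  smul c v := by
    rw [pullbackForm_eq_sum, pullbackForm_eq_sum, Finset.mul_sum]
    refine Finset.sum_congr rfl fun a _ ↦ ?_
    rw [Finset.mul_sum]
    refine Finset.sum_congr rfl fun b _ ↦ ?_
    simp
    ring
  pos v hv := pullbackForm_self_pos he g hy hv

/-- The differential of the inverse chart is onto, so both suprema run over the same set of numbers.
-/
theorem normSqDiff_chart (he : e ∈ atlas (EuclideanSpace ℝ (Fin n)) M) (g : Metr n M)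
    {v : M → ℝ} (hv : ContMDiff (𝓡 n) 𝓘(ℝ, ℝ) ∞ v) {y : EuclideanSpace ℝ (Fin n)}
    (hy : y ∈ e.target) : normSqDiff g v (e.symm y) =
      dualNormSq (fun X ↦ pullbackForm g e.symm y X X) (fderiv ℝ (v ∘ e.symm) y) := by
  have hsurj := (mdifferentiable_atlas he).symm.mfderiv_surjective hy
  have hd : ∀ ξ : EuclideanSpace ℝ (Fin n), fderiv ℝ (v ∘ e.symm) y ξ =
      mfderiv (𝓡 n) 𝓘(ℝ, ℝ) v (e.symm y) (mfderiv (𝓡 n) (𝓡 n) e.symm y ξ) := by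
    intro ξ
    rw [← mfderiv_eq_fderiv, mfderiv_comp y
      ((hv _).mdifferentiableAt (by simp)) ((mdifferentiable_atlas he).mdifferentiableAt_symm hy)]
    rfl
  rw [normSqDiff, dualNormSq]
  congr 1
  ext r
  constructor
  · rintro ⟨X, hX, rfl⟩
    obtain ⟨ξ, rfl⟩ := hsurj X
    exact ⟨ξ, hX, congrArg (· ^ 2) (hd ξ).symm⟩
  · rintro ⟨ξ, hξ, rfl⟩
    exact ⟨mfderiv (𝓡 n) (𝓡 n) e.symm y ξ, hξ, congrArg (· ^ 2) (hd ξ)⟩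

theorem continuous_normSqDiff (hn : 0 < n) (g : Metr n M) {v : M → ℝ}
    (hv : ContMDiff (𝓡 n) 𝓘(ℝ, ℝ) ∞ v) : Continuous (normSqDiff g v) := by
  have : Nonempty (Fin n) := ⟨⟨0, hn⟩⟩
  have : Nontrivial (EuclideanSpace ℝ (Fin n)) := inferInstance
  rw [continuous_iff_continuousAt]
  intro x
  set e := chartAt (EuclideanSpace ℝ (Fin n)) x
  have he : e ∈ atlas (EuclideanSpace ℝ (Fin n)) M := chart_mem_atlas _ x
  have hx : x ∈ e.source := mem_chart_source _ x
  have hvs : ContDiffOn ℝ ∞ (v ∘ e.symm) e.target := by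
    rw [← contMDiffOn_iff_contDiffOn]
    exact hv.comp_contMDiffOn (contMDiffOn_atlas_symm he)
  have hc : ContinuousOn (fun y ↦ dualNormSq (fun X ↦ pullbackForm g e.symm y X X)
      (fderiv ℝ (v ∘ e.symm) y)) e.target := by
    refine continuousOn_dualNormSq (fun y hy ↦ isPosQuad_pullbackForm he g hy) ?_
      (hvs.continuousOn_fderiv_of_isOpen e.open_target (by simp))
    have : (fun q : EuclideanSpace ℝ (Fin n) × EuclideanSpace ℝ (Fin n) ↦
        pullbackForm g e.symm q.1 q.2 q.2) =
        fun q ↦ ∑ a, ∑ b, q.2 a * q.2 b * metricCoeff e g q.1 a b := by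
      funext q
      rw [pullbackForm_eq_sum]
      rfl
    rw [this]
    refine continuousOn_finsetSum _ fun a _ ↦ continuousOn_finsetSum _ fun b _ ↦ ?_
    refine ContinuousOn.mul (by fun_prop) ?_
    exact (metricCoeff_smooth he g a b).continuousOn.comp continuousOn_fst fun q hq ↦ hq.1
  have h2 : ContinuousOn (fun z ↦ dualNormSq (fun X ↦ pullbackForm g e.symm (e z) X X)
      (fderiv ℝ (v ∘ e.symm) (e z))) e.source := hc.comp e.continuousOn e.mapsTo
  refine (h2.continuousAt (e.open_source.mem_nhds hx)).congr ?_
  filter_upwards [e.open_source.mem_nhds hx] with z hz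
  rw [← normSqDiff_chart he g hv (e.map_source hz), e.left_inv hz]

end NormSqDiff

/-! ### Comparison and local finiteness of the Riemannian measures -/

section Volume

variable {n : ℕ} {M : Type*} [TopologicalSpace M] [ChartedSpace (EuclideanSpace ℝ (Fin n)) M]
  [IsManifold (𝓡 n) ∞ M] {e : OpenPartialHomeomorph M (EuclideanSpace ℝ (Fin n))}

/-- The density of the volume measure of `h` with respect to that of `g`, computed in the chart
`e`. -/
def volRatioIn (e : OpenPartialHomeomorph M (EuclideanSpace ℝ (Fin n))) (g h : Metr n M)
    (x : M) : ℝ :=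
  √((metricCoeff e h (e x)).det / (metricCoeff e g (e x)).det)

/-- The density of the volume measure of `h` with respect to that of `g`. -/
def volRatio (g h : Metr n M) (x : M) : ℝ :=
  volRatioIn (chartAt (EuclideanSpace ℝ (Fin n)) x) g h x

/-- Both determinants acquire the same factor `(det J)²` under a change of chart. -/
theorem volRatio_eq (he : e ∈ atlas (EuclideanSpace ℝ (Fin n)) M) (g h : Metr n M) {x : M}
    (hx : x ∈ e.source) : volRatio g h x = volRatioIn e g h x := by
  rw [volRatio]
  have hca := chart_mem_atlas (EuclideanSpace ℝ (Fin n)) x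
  have hxc := mem_chart_source (EuclideanSpace ℝ (Fin n)) x
  generalize chartAt (EuclideanSpace ℝ (Fin n)) x = c at hca hxc ⊢
  have hy : c x ∈ transDomain e c :=
    ⟨c.map_source hxc, by rwa [Set.mem_preimage, c.left_inv hxc]⟩
  have hg := metricCoeff_isCoordPullback he hca g
  have hh := metricCoeff_isCoordPullback he hca h
  have hJ := hg.jacobi_ne _ hy
  rw [volRatioIn, volRatioIn, hg.eq _ hy, hh.eq _ hy]
  simp only [Matrix.det_mul, Matrix.det_transpose, Function.comp, c.left_inv hxc]
  congr 1
  rw [mul_div_mul_right _ _ hJ, mul_div_mul_left _ _ hJ]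

theorem volRatio_pos (g h : Metr n M) (x : M) : 0 < volRatio g h x := by
  have hm := (chartAt (EuclideanSpace ℝ (Fin n)) x).map_source (mem_chart_source _ x)
  exact Real.sqrt_pos.2 (div_pos (metricCoeff_det_pos (chart_mem_atlas _ x) h hm)
    (metricCoeff_det_pos (chart_mem_atlas _ x) g hm))

theorem continuous_volRatio (g h : Metr n M) : Continuous (volRatio g h) := by
  rw [continuous_iff_continuousAt]
  intro x
  set e := chartAt (EuclideanSpace ℝ (Fin n)) x
  have he : e ∈ atlas (EuclideanSpace ℝ (Fin n)) M := chart_mem_atlas _ x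
  have hx := e.open_source.mem_nhds (mem_chart_source (EuclideanSpace ℝ (Fin n)) x)
  have hc : ContinuousOn (volRatioIn e g h) e.source :=
    (((metricCoeff_smooth he h).det.continuousOn.div (metricCoeff_smooth he g).det.continuousOn
      fun y hy ↦ (metricCoeff_det_pos he g hy).ne').comp e.continuousOn e.mapsTo).sqrt
  refine (hc.continuousAt hx).congr ?_
  filter_upwards [hx] with z hz
  exact (volRatio_eq he g h hz).symm

theorem det_fderiv_eq_det_jacobi {τ : EuclideanSpace ℝ (Fin n) → EuclideanSpace ℝ (Fin n)}
    {y : EuclideanSpace ℝ (Fin n)} (hτ : DifferentiableAt ℝ τ y) :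
    (fderiv ℝ τ y).det = (jacobi τ y).det := by
  rw [ContinuousLinearMap.det,
    ← LinearMap.det_toMatrix (EuclideanSpace.basisFun (Fin n) ℝ).toBasis]
  congr 1
  ext a i
  rw [LinearMap.toMatrix_apply, ← fderiv_apply_eq_jacobi hτ]
  simp

section Measure

variable [SecondCountableTopology M] [Nonempty M] [MeasurableSpace M]

variable (n M) in
/-- The `i`-th chart in the definition of the volume measure. -/
def volChart (i : ℕ) : OpenPartialHomeomorph M (EuclideanSpace ℝ (Fin n)) :=
  chartAt (EuclideanSpace ℝ (Fin n)) (chartSeq n M i)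

variable (n M) in
/-- The `i`-th piece in the definition of the volume measure. -/
def volPiece (i : ℕ) : Set M := disjointed (fun j ↦ (volChart n M j).source) i

variable (n M) in
/-- The `i`-th piece in the definition of the volume measure, seen in the `i`-th chart. -/
def volDomain (i : ℕ) : Set (EuclideanSpace ℝ (Fin n)) :=
  (volChart n M i).target ∩ (volChart n M i).symm ⁻¹' volPiece n M i

theorem volChart_mem (i : ℕ) : volChart n M i ∈ atlas (EuclideanSpace ℝ (Fin n)) M :=
  chart_mem_atlas _ _

theorem volMeasure_eq (g : Metr n M) : volMeasure g = Measure.sum fun i ↦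
    (((volume : Measure (EuclideanSpace ℝ (Fin n))).restrict (volDomain n M i)).withDensity
      fun y ↦ ENNReal.ofReal √(metricCoeff (volChart n M i) g y).det).map
        (volChart n M i).symm := rfl

variable [BorelSpace M]

theorem measurableSet_volPiece (i : ℕ) : MeasurableSet (volPiece n M i) :=
  MeasurableSet.disjointed (fun j ↦ (volChart n M j).open_source.measurableSet) i

theorem measurableSet_inter_preimage_symm
    (e : OpenPartialHomeomorph M (EuclideanSpace ℝ (Fin n))) {A : Set M}
    (hA : MeasurableSet A) : MeasurableSet (e.target ∩ e.symm ⁻¹' A) := by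
  classical
  -- The inverse chart is continuous only on its target; it is replaced by a constant elsewhere to
  -- get a globally measurable map.
  have h := e.symm.continuousOn.measurable_piecewise (g := fun _ ↦ Classical.arbitrary M)
    continuousOn_const e.open_target.measurableSet
  have h2 := e.open_target.measurableSet.inter (h hA)
  convert h2 using 1
  ext y
  simp only [Set.mem_inter_iff, Set.mem_preimage]
  refine and_congr_right fun hy ↦ ?_
  rw [Set.piecewise_eq_of_mem _ _ _ (by exact hy)]

theorem measurableSet_volDomain (i : ℕ) : MeasurableSet (volDomain n M i) :=
  measurableSet_inter_preimage_symm _ (measurableSet_volPiece i)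

theorem aemeasurable_symm_volDomain (i : ℕ) : AEMeasurable (volChart n M i).symm
    ((volume : Measure (EuclideanSpace ℝ (Fin n))).restrict (volDomain n M i)) :=
  ((volChart n M i).symm.continuousOn.mono Set.inter_subset_left).aemeasurable
    (measurableSet_volDomain i)

theorem aemeasurable_density (g : Metr n M) (i : ℕ) :
    AEMeasurable (fun y ↦ ENNReal.ofReal √(metricCoeff (volChart n M i) g y).det)
      ((volume : Measure (EuclideanSpace ℝ (Fin n))).restrict (volDomain n M i)) :=
  (((metricCoeff_smooth (volChart_mem i) g).det.continuousOn.sqrt.mono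
    Set.inter_subset_left).aemeasurable (measurableSet_volDomain i)).ennreal_ofReal

theorem lintegral_volMeasure (g : Metr n M) {f : M → ENNReal} (hf : Measurable f) :
    ∫⁻ x, f x ∂(volMeasure g) = ∑' i, ∫⁻ y in volDomain n M i,
      ENNReal.ofReal √(metricCoeff (volChart n M i) g y).det * f ((volChart n M i).symm y) := by
  rw [volMeasure_eq, lintegral_sum_measure]
  refine tsum_congr fun i ↦ ?_
  have h1 := aemeasurable_symm_volDomain (n := n) (M := M) i
  have h2 := h1.mono_ac (withDensity_absolutelyContinuous _
    fun y ↦ ENNReal.ofReal √(metricCoeff (volChart n M i) g y).det)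
  rw [lintegral_map' hf.aemeasurable h2]
  exact lintegral_withDensity_eq_lintegral_mul₀ (aemeasurable_density g i)
    (hf.comp_aemeasurable h1)

/-- Both measures are built from the same charts and pieces, so comparing the densities piece by
piece suffices and no change of variables occurs. -/
theorem volMeasure_eq_withDensity (g h : Metr n M) :
    volMeasure h = (volMeasure g).withDensity fun x ↦ ENNReal.ofReal (volRatio g h x) := by
  have hm : Measurable fun x ↦ ENNReal.ofReal (volRatio g h x) :=
    (continuous_volRatio g h).measurable.ennreal_ofReal
  ext S hS
  have hmS : Measurable (S.indicator (1 : M → ENNReal)) := measurable_one.indicator hS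
  rw [← lintegral_indicator_one hS, ← lintegral_indicator_one hS,
    lintegral_withDensity_eq_lintegral_mul _ hm hmS, lintegral_volMeasure h hmS,
    lintegral_volMeasure g (hm.mul hmS)]
  refine tsum_congr fun i ↦ setLIntegral_congr_fun (measurableSet_volDomain i) fun y hy ↦ ?_
  have hsrc := (volChart n M i).map_target hy.1
  have hgpos := metricCoeff_det_pos (volChart_mem i) g hy.1
  simp only [Pi.mul_apply]
  rw [← mul_assoc, ← ENNReal.ofReal_mul (Real.sqrt_nonneg _), volRatio_eq (volChart_mem i) g h hsrc,
    volRatioIn, (volChart n M i).right_inv hy.1, ← Real.sqrt_mul hgpos.le,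
    mul_div_cancel₀ _ hgpos.ne']

/-- Infinitely many pieces may meet a neighbourhood of `x`, so a bound for each piece is not enough.
All parts of a small compact neighbourhood are transported into one chart at `x`. There they become
disjoint subsets of a closed ball on which the density is bounded. -/
theorem isFiniteMeasureOnCompacts_volMeasure [T2Space M] (g : Metr n M) :
    IsFiniteMeasureOnCompacts (volMeasure g) := by
  have : IsLocallyFiniteMeasure (volMeasure g) := by
    refine ⟨fun x ↦ ?_⟩
    set e := chartAt (EuclideanSpace ℝ (Fin n)) x with he_def
    have he : e ∈ atlas (EuclideanSpace ℝ (Fin n)) M := chart_mem_atlas _ x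
    have hx : x ∈ e.source := mem_chart_source _ x
    obtain ⟨r, hr, hB⟩ := Metric.nhds_basis_closedBall.mem_iff.1
      (e.open_target.mem_nhds (e.map_source hx))
    set B := Metric.closedBall (e x) r with hBdef
    have hBc : IsCompact B := isCompact_closedBall _ _
    set N := e.symm '' B with hN
    have hNc : IsCompact N := hBc.image_of_continuousOn (e.symm.continuousOn.mono hB)
    have hNm : MeasurableSet N := hNc.isClosed.measurableSet
    refine ⟨N, e.symm.image_mem_nhds (e.map_source hx) (Metric.closedBall_mem_nhds _ hr) |>
      fun h ↦ by rwa [e.left_inv hx] at h, ?_⟩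
    have hNs : N ⊆ e.source := by
      rintro _ ⟨y, hy, rfl⟩
      exact e.map_target (hB hy)
    set ρ : EuclideanSpace ℝ (Fin n) → ENNReal := fun y ↦ ENNReal.ofReal √(metricCoeff e g y).det
    set S : ℕ → Set (EuclideanSpace ℝ (Fin n)) := fun i ↦ (volChart n M i).target ∩
      (volChart n M i).symm ⁻¹' (volPiece n M i ∩ N) with hS
    have hSm : ∀ i, MeasurableSet (S i) := fun i ↦
      measurableSet_inter_preimage_symm _ ((measurableSet_volPiece i).inter hNm)
    have hStrans : ∀ i, S i ⊆ transDomain e (volChart n M i) := fun i y hy ↦ ⟨hy.1, hNs hy.2.2⟩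
    set τ : ℕ → EuclideanSpace ℝ (Fin n) → EuclideanSpace ℝ (Fin n) :=
      fun i ↦ e ∘ (volChart n M i).symm with hτ
    have himage : ∀ i, τ i '' S i = e.target ∩ e.symm ⁻¹' (volPiece n M i ∩ N) := by
      intro i
      ext z
      constructor
      · rintro ⟨y, hy, rfl⟩
        refine ⟨e.map_source (hNs hy.2.2), ?_⟩
        change e.symm (e ((volChart n M i).symm y)) ∈ volPiece n M i ∩ N
        rw [e.left_inv (hNs hy.2.2)]
        exact hy.2
      · rintro ⟨hz, hz2⟩
        have hsrc : e.symm z ∈ (volChart n M i).source :=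
          disjointed_subset (fun j ↦ (volChart n M j).source) i hz2.1
        refine ⟨volChart n M i (e.symm z), ⟨(volChart n M i).map_source hsrc, ?_⟩, ?_⟩
        · rw [Set.mem_preimage, (volChart n M i).left_inv hsrc]
          exact hz2
        · simp only [hτ, Function.comp]
          rw [(volChart n M i).left_inv hsrc, e.right_inv hz]
    have himm : ∀ i, MeasurableSet (τ i '' S i) := fun i ↦ by
      rw [himage]
      exact measurableSet_inter_preimage_symm _ ((measurableSet_volPiece i).inter hNm)
    have hdisj : Pairwise (Function.onFun Disjoint fun i ↦ τ i '' S i) := by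
      intro i j hij
      simp only [Function.onFun, himage]
      refine Set.disjoint_left.2 fun z hz hz' ↦ ?_
      exact Set.disjoint_left.1 (disjoint_disjointed (fun j ↦ (volChart n M j).source) hij)
        hz.2.1 hz'.2.1
    have hsub : (⋃ i, τ i '' S i) ⊆ B := by
      refine Set.iUnion_subset fun i ↦ ?_
      rw [himage]
      rintro z ⟨hz, -, y, hy, hyz⟩
      rwa [← e.symm.injOn (hB hy) hz hyz]
    -- Change of variables by `τ i`: the factor `|det J|` is exactly what relates `√det` in the two
    -- charts.
    have hpiece : ∀ i, ∫⁻ y in volDomain n M i,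
        ENNReal.ofReal √(metricCoeff (volChart n M i) g y).det *
          N.indicator 1 ((volChart n M i).symm y) = ∫⁻ z in τ i '' S i, ρ z := by
      intro i
      have hpull := metricCoeff_isCoordPullback he (volChart_mem i) g
      have hinj : Set.InjOn (τ i) (S i) := by
        intro y hy y' hy' h
        exact (volChart n M i).symm.injOn hy.1 hy'.1
          (e.injOn (hNs hy.2.2) (hNs hy'.2.2) h)
      rw [lintegral_image_eq_lintegral_abs_det_fderiv_mul volume (hSm i)
        (fun y hy ↦ (hpull.differentiableAt (hStrans i hy)).hasFDerivAt.hasFDerivWithinAt) hinj]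
      have hSD : S i = (volChart n M i).symm ⁻¹' N ∩ volDomain n M i := by
        ext y
        simp only [hS, volDomain, Set.mem_inter_iff, Set.mem_preimage]
        tauto
      have hind : ∀ y, ENNReal.ofReal √(metricCoeff (volChart n M i) g y).det *
          N.indicator (1 : M → ENNReal) ((volChart n M i).symm y) =
          ((volChart n M i).symm ⁻¹' N).indicator
            (fun y ↦ ENNReal.ofReal √(metricCoeff (volChart n M i) g y).det) y := by
        intro y
        by_cases hy : (volChart n M i).symm y ∈ N
        · rw [Set.indicator_of_mem hy, Set.indicator_of_mem (by exact hy)]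
          simp
        · rw [Set.indicator_of_notMem hy, Set.indicator_of_notMem (by exact hy)]
          simp
      have h1 : ∫⁻ y in volDomain n M i,
          ENNReal.ofReal √(metricCoeff (volChart n M i) g y).det *
            N.indicator 1 ((volChart n M i).symm y) =
          ∫⁻ y in S i, ENNReal.ofReal √(metricCoeff (volChart n M i) g y).det := by
        rw [← lintegral_indicator (measurableSet_volDomain i), ← lintegral_indicator (hSm i)]
        congr 1
        funext y
        by_cases hy : y ∈ volDomain n M i
        · rw [Set.indicator_of_mem hy, hind, hSD, Set.inter_comm, ← Set.indicator_indicator,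
            Set.indicator_of_mem hy]
        · rw [Set.indicator_of_notMem hy, Set.indicator_of_notMem]
          rw [hSD]
          exact fun h ↦ hy h.2
      rw [h1]
      refine setLIntegral_congr_fun (hSm i) fun y hy ↦ ?_
      have hyt := hStrans i hy
      simp only [ρ]
      rw [det_fderiv_eq_det_jacobi (hpull.differentiableAt hyt),
        ← ENNReal.ofReal_mul (abs_nonneg _), hpull.eq y hyt]
      simp only [Matrix.det_mul, Matrix.det_transpose]
      congr 1
      rw [mul_right_comm, ← sq, Real.sqrt_mul (sq_nonneg _), Real.sqrt_sq_eq_abs]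
    rw [← lintegral_indicator_one hNm, lintegral_volMeasure g (measurable_one.indicator hNm)]
    simp only [hpiece]
    rw [← lintegral_iUnion himm hdisj]
    refine (lintegral_mono_set hsub).trans_lt ?_
    have hcont : ContinuousOn (fun y ↦ √(metricCoeff e g y).det) B :=
      ((metricCoeff_smooth he g).det.continuousOn.sqrt).mono hB
    exact (hcont.integrableOn_compact hBc).lintegral_lt_top
  exact isFiniteMeasureOnCompacts_of_isLocallyFiniteMeasure

end Measure

end Volume

/-! ### Scalar curvature as a continuous function of the 2-jet -/

section JetScal

variable {n : ℕ}

/-- The Christoffel symbol, as a function of the inverse matrix `I` and of the first derivatives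
`B` of the metric. -/
def jetChrist (I : Matrix (Fin n) (Fin n) ℝ) (B : Fin n → Fin n → Fin n → ℝ) (k i j : Fin n) : ℝ :=
  (1 / 2 : ℝ) * ∑ l, I k l * (B i j l + B j i l - B l i j)

/-- The derivative of the Christoffel symbol, as a function of the inverse matrix `I` and of the
first and second derivatives `B`, `C` of the metric. -/
def jetDChrist (I : Matrix (Fin n) (Fin n) ℝ) (B : Fin n → Fin n → Fin n → ℝ)
    (C : Fin n → Fin n → Fin n → Fin n → ℝ) (m k i j : Fin n) : ℝ :=
  (1 / 2 : ℝ) * ∑ l, ((-∑ b, (∑ a, I k a * B m a b) * I b l) * (B i j l + B j i l - B l i j) +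
    I k l * (C m i j l + C m j i l - C m l i j))

/-- The scalar curvature, as a function of the inverse matrix `I` and of the first and second
derivatives `B`, `C` of the metric. -/
def jetScal (I : Matrix (Fin n) (Fin n) ℝ) (B : Fin n → Fin n → Fin n → ℝ)
    (C : Fin n → Fin n → Fin n → Fin n → ℝ) : ℝ :=
  ∑ i, ∑ j, I i j * ((∑ k, (jetDChrist I B C k k i j - jetDChrist I B C j k i k)) +
    ∑ k, ∑ l, (jetChrist I B k k l * jetChrist I B l i j -
      jetChrist I B k j l * jetChrist I B l i k))

theorem continuous_jetScal : Continuous fun q : Matrix (Fin n) (Fin n) ℝ ×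
    (Fin n → Fin n → Fin n → ℝ) × (Fin n → Fin n → Fin n → Fin n → ℝ) ↦
      jetScal q.1 q.2.1 q.2.2 := by
  have h0 : ∀ i j, Continuous fun q : Matrix (Fin n) (Fin n) ℝ ×
    (Fin n → Fin n → Fin n → ℝ) × (Fin n → Fin n → Fin n → Fin n → ℝ) ↦ q.1 i j :=
    fun i j ↦ continuous_fst.matrix_elem i j
  have h1 : ∀ k i j, Continuous fun q : Matrix (Fin n) (Fin n) ℝ ×
    (Fin n → Fin n → Fin n → ℝ) × (Fin n → Fin n → Fin n → Fin n → ℝ) ↦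
      jetChrist q.1 q.2.1 k i j := by
    intro k i j
    unfold jetChrist
    fun_prop
  have h2 : ∀ m k i j, Continuous fun q : Matrix (Fin n) (Fin n) ℝ ×
    (Fin n → Fin n → Fin n → ℝ) × (Fin n → Fin n → Fin n → Fin n → ℝ) ↦
      jetDChrist q.1 q.2.1 q.2.2 m k i j := by
    intro m k i j
    unfold jetDChrist
    fun_prop
  unfold jetScal
  fun_prop

/-- The derivative of the Christoffel symbols follows from the product rule and `∂(G⁻¹) = -G⁻¹ (∂G)
G⁻¹`. Only derivatives of `G` up to order two occur. -/
theorem IsCoordMetricOn.scalCoord_eq_jetScal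
    {G : EuclideanSpace ℝ (Fin n) → Matrix (Fin n) (Fin n) ℝ}
    {s : Set (EuclideanSpace ℝ (Fin n))} {y : EuclideanSpace ℝ (Fin n)}
    (hG : IsCoordMetricOn G s) (hy : y ∈ s) :
    scalCoord G y = jetScal (G y)⁻¹ (fun k i j ↦ pderiv k (fun z ↦ G z i j) y)
      (fun l k i j ↦ pderiv l (pderiv k (fun z ↦ G z i j)) y) := by
  have hD : ∀ m k i j, pderiv m (christoffel G k i j) y =
      jetDChrist (G y)⁻¹ (fun k i j ↦ pderiv k (fun z ↦ G z i j) y)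
        (fun l k i j ↦ pderiv l (pderiv k (fun z ↦ G z i j)) y) m k i j := by
    intro m k i j
    have hinv := (hG.smooth.inv hG.det_ne).differentiableAt hG.isOpen hy
    have hp : ∀ a b c, DifferentiableAt ℝ (pderiv a fun z ↦ G z b c) y := fun a b c ↦
      differentiableAt_of_contDiffOn hG.isOpen (ContDiffOn.pderiv hG.isOpen (hG.smooth b c) a) hy
    have hinvd : ∀ a b, pderiv m (fun z ↦ (G z)⁻¹ a b) y =
        -∑ d, (∑ c, (G y)⁻¹ a c * pderiv m (fun z ↦ G z c d) y) * (G y)⁻¹ d b := by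
      intro a b
      have := congrFun (congrFun (mpderiv_inv hG.isOpen hG.smooth hG.det_ne hy m) a) b
      simpa only [mpderiv, Matrix.of_apply, Matrix.neg_apply, Matrix.mul_apply] using this
    have hsum : ∀ l, DifferentiableAt ℝ (fun z ↦ pderiv i (fun z ↦ G z j l) z +
        pderiv j (fun z ↦ G z i l) z - pderiv l (fun z ↦ G z i j) z) y := fun l ↦
      ((hp i j l).add (hp j i l)).sub (hp l i j)
    have hprod : ∀ l, DifferentiableAt ℝ (fun z ↦ (G z)⁻¹ k l * (pderiv i (fun z ↦ G z j l) z +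
        pderiv j (fun z ↦ G z i l) z - pderiv l (fun z ↦ G z i j) z)) y := fun l ↦
      (hinv k l).mul (hsum l)
    have e1 : pderiv m (christoffel G k i j) y = (1 / 2 : ℝ) *
        pderiv m (fun z ↦ ∑ l, (G z)⁻¹ k l * (pderiv i (fun z ↦ G z j l) z +
          pderiv j (fun z ↦ G z i l) z - pderiv l (fun z ↦ G z i j) z)) y := by
      have := pderiv_mul (f := fun _ ↦ (1 / 2 : ℝ)) (differentiableAt_const _)
        (DifferentiableAt.fun_sum fun l (_ : l ∈ Finset.univ) ↦ hprod l) m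
      refine this.trans ?_
      simp [pderiv]
    rw [e1, jetDChrist, pderiv_sum (f := fun l z ↦ (G z)⁻¹ k l * (pderiv i (fun z ↦ G z j l) z +
        pderiv j (fun z ↦ G z i l) z - pderiv l (fun z ↦ G z i j) z)) fun l _ ↦ hprod l]
    congr 1
    refine Finset.sum_congr rfl fun l _ ↦ ?_
    rw [pderiv_mul (hinv k l) (hsum l), hinvd,
      pderiv_sub (f := fun z ↦ pderiv i (fun z ↦ G z j l) z + pderiv j (fun z ↦ G z i l) z)
        ((hp i j l).add (hp j i l)) (hp l i j), pderiv_add (hp i j l) (hp j i l)]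
  simp only [scalCoord, ricci, hD, jetScal]
  rfl

theorem continuousAt_matrix_inv {A : Matrix (Fin n) (Fin n) ℝ} (hA : A.det ≠ 0) :
    ContinuousAt (fun B : Matrix (Fin n) (Fin n) ℝ ↦ B⁻¹) A := by
  have h : ContinuousAt (fun B : Matrix (Fin n) (Fin n) ℝ ↦ B.det⁻¹ • B.adjugate) A :=
    ((continuous_id.matrix_det.continuousAt).inv₀ hA).smul
      continuous_id.matrix_adjugate.continuousAt
  simpa only [Matrix.inv_def, Ring.inverse_eq_inv'] using h

end JetScal

/-! ### Fine neighbourhoods and pointwise closeness -/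

section JetNhds

/-- The model space of the bundle of 2-jets of metrics. -/
abbrev JetModel (n : ℕ) : Type :=
  EuclideanSpace ℝ (Fin n) × (Fin n → Fin n → ℝ) × (Fin n → Fin n → Fin n → ℝ) ×
    (Fin n → Fin n → Fin n → Fin n → ℝ)

variable {n : ℕ} {M : Type*} [TopologicalSpace M] [ChartedSpace (EuclideanSpace ℝ (Fin n)) M]
  [IsManifold (𝓡 n) ∞ M] {e : OpenPartialHomeomorph M (EuclideanSpace ℝ (Fin n))}

/-- The closeness of two metrics at a point, up to the relative or absolute error `ε`. -/
structure CloseAt (g h : Metr n M) (ε : ℝ) (x : M) : Prop where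
  inner_le : ∀ X : EuclideanSpace ℝ (Fin n),
    |h.inner x X X - g.inner x X X| ≤ ε * g.inner x X X
  scal_le : |scal h x - scal g x| ≤ ε
  vol_le : |volRatio g h x - 1| ≤ ε

theorem CloseAt.mono {g h : Metr n M} {ε ε' : ℝ} {x : M} (hc : CloseAt g h ε x) (hε : ε ≤ ε') :
    CloseAt g h ε' x where
  inner_le X := (hc.inner_le X).trans
    (mul_le_mul_of_nonneg_right hε ((isPosQuad_inner g x).nonneg X))
  scal_le := hc.scal_le.trans hε
  vol_le := hc.vol_le.trans hε

theorem continuousOn_scalCoord_metricCoeff (he : e ∈ atlas (EuclideanSpace ℝ (Fin n)) M)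
    (g : Metr n M) : ContinuousOn (scalCoord (metricCoeff e g)) e.target := by
  have hG := metricCoeff_isCoordMetricOn he g
  have hp : ∀ k i j, ContDiffOn ℝ ∞ (pderiv k fun z ↦ metricCoeff e g z i j) e.target :=
    fun k i j ↦ ContDiffOn.pderiv hG.isOpen (hG.smooth i j) k
  have h1 : ContinuousOn (fun y ↦ ((metricCoeff e g y)⁻¹,
      (fun k i j ↦ pderiv k (fun z ↦ metricCoeff e g z i j) y : Fin n → Fin n → Fin n → ℝ),
      (fun l k i j ↦ pderiv l (pderiv k (fun z ↦ metricCoeff e g z i j)) y :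
        Fin n → Fin n → Fin n → Fin n → ℝ))) e.target := by
    refine ContinuousOn.prodMk ?_ (ContinuousOn.prodMk ?_ ?_)
    · exact continuousOn_pi.2 fun i ↦ continuousOn_pi.2 fun j ↦
        (hG.smooth.inv hG.det_ne i j).continuousOn
    · exact continuousOn_pi.2 fun k ↦ continuousOn_pi.2 fun i ↦ continuousOn_pi.2 fun j ↦
        (hp k i j).continuousOn
    · exact continuousOn_pi.2 fun l ↦ continuousOn_pi.2 fun k ↦ continuousOn_pi.2 fun i ↦
        continuousOn_pi.2 fun j ↦ (ContDiffOn.pderiv hG.isOpen (hp k i j) l).continuousOn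
  refine (continuous_jetScal.comp_continuousOn h1).congr fun y hy ↦ ?_
  exact hG.scalCoord_eq_jetScal hy

theorem continuous_scal (g : Metr n M) : Continuous (scal g) := by
  rw [continuous_iff_continuousAt]
  intro x
  set e := chartAt (EuclideanSpace ℝ (Fin n)) x
  have he : e ∈ atlas (EuclideanSpace ℝ (Fin n)) M := chart_mem_atlas _ x
  have hx := e.open_source.mem_nhds (mem_chart_source (EuclideanSpace ℝ (Fin n)) x)
  refine (((continuousOn_scalCoord_metricCoeff he g).comp e.continuousOn
    e.mapsTo).continuousAt hx).congr ?_
  filter_upwards [hx] with z hz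
  exact (scal_eq he g hz).symm

/-- The vector `ξ` serves all metrics at once, so that two metrics at `x` can be compared through
their coefficient matrices. -/
theorem inner_eq_pullbackForm (he : e ∈ atlas (EuclideanSpace ℝ (Fin n)) M) {x : M}
    (hx : x ∈ e.source) (X : EuclideanSpace ℝ (Fin n)) :
    ∃ ξ, ∀ g : Metr n M, g.inner x X X = pullbackForm g e.symm (e x) ξ ξ := by
  obtain ⟨ξ, hξ⟩ := (mdifferentiable_atlas he).symm.mfderiv_surjective (e.map_source hx) X
  refine ⟨ξ, fun g ↦ ?_⟩
  refine (inner_congr g (e.left_inv hx).symm X X).trans ?_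
  have h2 : (X : EuclideanSpace ℝ (Fin n)) = mfderiv (𝓡 n) (𝓡 n) e.symm (e x) ξ := hξ.symm
  rw [h2]
  rfl

/-- In jet coordinates `z` over a chart at `x`, the conditions compare the jet `z` with `g` at the
moving base point `z.1`. At the jet of `g` at `x` the errors vanish, so by continuity the conditions
hold on a neighbourhood. -/
theorem exists_isOpen_closeAt (g : Metr n M) (x : M) {O : Set M} (hO : IsOpen O) (hxO : x ∈ O)
    {ε : ℝ} (hε : 0 < ε) : ∃ V : Set (JetBundle n M), IsOpen V ∧ jet g x ∈ V ∧
      ∀ (h : Metr n M) (y : M), jet h y ∈ V → y ∈ O ∧ CloseAt g h ε y := by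
  set e := chartAt (EuclideanSpace ℝ (Fin n)) x
  have he : e ∈ atlas (EuclideanSpace ℝ (Fin n)) M := chart_mem_atlas _ x
  have hx : x ∈ e.source := mem_chart_source _ x
  have hy0 := e.map_source hx
  have hG := metricCoeff_isCoordMetricOn he g
  have hdet := hG.det_ne _ hy0
  set z0 : JetModel n := jetCoord e (x, g) with hz0
  have hy1 : ContinuousAt (fun z : JetModel n ↦ z.1) z0 := continuous_fst.continuousAt
  have htarget := e.open_target.mem_nhds hy0
  have hGc : ∀ a b, ContinuousAt (fun z : JetModel n ↦ metricCoeff e g z.1 a b) z0 := fun a b ↦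
    ContinuousAt.comp (x := z0) (f := fun z : JetModel n ↦ z.1)
      ((hG.smooth a b).continuousOn.continuousAt htarget) hy1
  have hdomain : ∀ᶠ z in 𝓝 z0, z.1 ∈ e.target ∩ e.symm ⁻¹' O := by
    refine hy1.eventually_mem ((e.symm.isOpen_inter_preimage hO).mem_nhds ⟨hy0, ?_⟩)
    change e.symm (e x) ∈ O
    rwa [e.left_inv hx]
  -- Compactness of the unit sphere makes the estimate uniform in the direction; homogeneity later
  -- extends it to all vectors.
  have hform : ∀ᶠ z in 𝓝 z0, ∀ ξ ∈ Metric.sphere (0 : EuclideanSpace ℝ (Fin n)) 1,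
      |(∑ a, ∑ b, ξ a * ξ b * z.2.1 a b) - ∑ a, ∑ b, ξ a * ξ b * metricCoeff e g z.1 a b| <
        ε * ∑ a, ∑ b, ξ a * ξ b * metricCoeff e g z.1 a b := by
    refine (isCompact_sphere _ _).eventually_forall_of_forall_eventually fun ξ hξ ↦ ?_
    have hq : ContinuousAt (fun q : JetModel n × EuclideanSpace ℝ (Fin n) ↦
        ∑ a, ∑ b, q.2 a * q.2 b * metricCoeff e g q.1.1 a b) (z0, ξ) := by
      refine tendsto_finsetSum _ fun a _ ↦ tendsto_finsetSum _ fun b _ ↦ ?_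
      refine ContinuousAt.mul (by fun_prop) ?_
      exact ContinuousAt.comp (x := (z0, ξ)) (f := Prod.fst) (hGc a b) continuousAt_fst
    refine ContinuousAt.eventually_lt (ContinuousAt.abs (ContinuousAt.sub ?_ hq))
      (continuousAt_const.mul hq) ?_
    · fun_prop
    · have hpos := pullbackForm_self_pos he g hy0 (ne_zero_of_mem_unit_sphere ⟨ξ, hξ⟩)
      rw [pullbackForm_eq_sum] at hpos
      have h0 : ∑ a, ∑ b, ξ a * ξ b * z0.2.1 a b =
        ∑ a, ∑ b, ξ a * ξ b * metricCoeff e g z0.1 a b := rfl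
      rw [h0, sub_self, abs_zero]
      exact mul_pos hε hpos
  have hscal : ∀ᶠ z in 𝓝 z0, |jetScal (Matrix.of z.2.1)⁻¹ z.2.2.1 z.2.2.2 -
      scalCoord (metricCoeff e g) z.1| < ε := by
    have h1 : ContinuousAt (fun z : JetModel n ↦ (Matrix.of z.2.1)⁻¹) z0 :=
      ContinuousAt.comp (x := z0) (f := fun z : JetModel n ↦ Matrix.of z.2.1)
        (continuousAt_matrix_inv hdet)
        (by exact (continuous_fst.comp continuous_snd).continuousAt)
    have h2 : ContinuousAt (fun z : JetModel n ↦ jetScal (Matrix.of z.2.1)⁻¹ z.2.2.1 z.2.2.2) z0 :=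
      ContinuousAt.comp (x := z0) (f := fun z : JetModel n ↦
        ((Matrix.of z.2.1)⁻¹, z.2.2.1, z.2.2.2))
        continuous_jetScal.continuousAt (h1.prodMk (by fun_prop))
    have h3 : ContinuousAt (fun z : JetModel n ↦ scalCoord (metricCoeff e g) z.1) z0 :=
      ContinuousAt.comp (x := z0) (f := fun z : JetModel n ↦ z.1)
        ((continuousOn_scalCoord_metricCoeff he g).continuousAt htarget) hy1
    refine ContinuousAt.eventually_lt (h2.sub h3).abs continuousAt_const ?_
    have h0 : jetScal (Matrix.of z0.2.1)⁻¹ z0.2.2.1 z0.2.2.2 =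
        scalCoord (metricCoeff e g) z0.1 := (hG.scalCoord_eq_jetScal hy0).symm
    rw [h0, sub_self, abs_zero]
    exact hε
  have hvol : ∀ᶠ z in 𝓝 z0,
      |√((Matrix.of z.2.1).det / (metricCoeff e g z.1).det) - 1| < ε := by
    have h1 : ContinuousAt (fun z : JetModel n ↦ (Matrix.of z.2.1).det) z0 :=
      (Continuous.matrix_det (by exact continuous_fst.comp continuous_snd)).continuousAt
    have h2 : ContinuousAt (fun z : JetModel n ↦ (metricCoeff e g z.1).det) z0 :=
      ContinuousAt.comp (x := z0) (f := fun z : JetModel n ↦ z.1)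
        (hG.smooth.det.continuousOn.continuousAt htarget) hy1
    refine ContinuousAt.eventually_lt (((h1.div h2 hdet).sqrt).sub continuousAt_const).abs
      continuousAt_const ?_
    have h0 : (Matrix.of z0.2.1).det = (metricCoeff e g z0.1).det := rfl
    rw [h0, div_self (by exact hdet)]
    simpa using hε
  obtain ⟨W, hW, hWo, hzW⟩ := eventually_nhds_iff.1 (hdomain.and (hform.and (hscal.and hvol)))
  refine ⟨Quotient.mk (jetSetoid n M) '' {q | q.1 ∈ e.source ∧ jetCoord e q ∈ W},
    TopologicalSpace.isOpen_generateFrom_of_mem ⟨e, he, W, hWo, rfl⟩,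
    ⟨(x, g), ⟨hx, hzW⟩, rfl⟩, ?_⟩
  rintro h y ⟨q, ⟨hqe, hqW⟩, hq⟩
  obtain ⟨hqy, hqj⟩ : (jetSetoid n M) q (y, h) := Quotient.exact hq
  -- The representative `q` of the jet need not be `(y, h)`, but its coordinates in `e` are the
  -- same.
  rw [hqj e he hqe] at hqW
  have hy : y ∈ e.source := by
    change (y, h).1 ∈ e.source
    rwa [← hqy]
  obtain ⟨h1, h2, h3, h4⟩ := hW _ hqW
  refine ⟨by simpa [jetCoord, e.left_inv hy] using h1.2, ⟨fun X ↦ ?_, ?_, ?_⟩⟩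
  · obtain ⟨ξ, hξ⟩ := inner_eq_pullbackForm he hy X
    rw [hξ, hξ]
    have hty := e.map_source hy
    rcases eq_or_ne ξ 0 with rfl | hne
    · rw [(isPosQuad_pullbackForm he h hty).zero, (isPosQuad_pullbackForm he g hty).zero]
      simp
    · have hsph : ‖ξ‖⁻¹ • ξ ∈ Metric.sphere (0 : EuclideanSpace ℝ (Fin n)) 1 := by
        simp [norm_smul, hne]
      have h5 : |pullbackForm h e.symm (e y) (‖ξ‖⁻¹ • ξ) (‖ξ‖⁻¹ • ξ) -
          pullbackForm g e.symm (e y) (‖ξ‖⁻¹ • ξ) (‖ξ‖⁻¹ • ξ)| <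
          ε * pullbackForm g e.symm (e y) (‖ξ‖⁻¹ • ξ) (‖ξ‖⁻¹ • ξ) := by
        have := h2 _ hsph
        rw [pullbackForm_eq_sum h, pullbackForm_eq_sum g]
        exact this
      rw [(isPosQuad_pullbackForm he h hty).smul, (isPosQuad_pullbackForm he g hty).smul,
        ← mul_sub, abs_mul, abs_of_nonneg (sq_nonneg _), mul_left_comm] at h5
      exact (lt_of_mul_lt_mul_left h5 (sq_nonneg _)).le
  · rw [scal_eq he h hy, scal_eq he g hy,
      (metricCoeff_isCoordMetricOn he h).scalCoord_eq_jetScal (e.map_source hy)]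
    exact h3.le
  · rw [volRatio_eq he g h hy]
    exact h4.le

/-- Metrics which are close to `g` in the fine `C²`-topology have pointwise `ε`-close coefficients,
scalar curvatures and volume densities, where `ε` may decay arbitrarily fast. -/
theorem exists_isOpen_closeAt_exhaustion (K : CompactExhaustion M) (g : Metr n M) {ε : ℕ → ℝ}
    (hε : ∀ i, 0 < ε i) (hanti : Antitone ε) :
    ∃ U : Set (JetBundle n M), IsOpen U ∧ Set.range (jet g) ⊆ U ∧
      ∀ h : Metr n M, Set.range (jet h) ⊆ U → ∀ x, CloseAt g h (ε (K.find x)) x := by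
  -- Points near `x` may need one more step of the exhaustion than `x`. The tolerance is therefore
  -- taken at index `K.find x + 1`, and antitonicity of `ε` makes it at most the one required at the
  -- nearby point.
  have hmem : ∀ x, x ∈ interior (K (K.find x + 1)) := fun x ↦
    K.subset_interior_succ _ (K.mem_find x)
  choose V hVo hgV hV using fun x ↦
    exists_isOpen_closeAt g x isOpen_interior (hmem x) (hε (K.find x + 1))
  refine ⟨⋃ x, V x, isOpen_iUnion hVo, ?_, fun h hh y ↦ ?_⟩
  · rintro _ ⟨x, rfl⟩
    exact Set.mem_iUnion.2 ⟨x, hgV x⟩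
  · obtain ⟨x, hx⟩ := Set.mem_iUnion.1 (hh ⟨y, rfl⟩)
    obtain ⟨h1, h2⟩ := hV x h y hx
    exact h2.mono (hanti (K.mem_iff_find_le.1 (interior_subset h1)))

end JetNhds

/-! ### Localization of the energy and stability of lower bounds -/

section Analysis

variable {n : ℕ} {M : Type*} [TopologicalSpace M] [ChartedSpace (EuclideanSpace ℝ (Fin n)) M]
  [IsManifold (𝓡 n) ∞ M]

variable (n M) in
/-- Nonnegative compactly supported smooth functions, including the zero function. -/
def nonnegTest : Set (M → ℝ) :=
  {v | ContMDiff (𝓡 n) 𝓘(ℝ, ℝ) ∞ v ∧ HasCompactSupport v ∧ ∀ x, 0 ≤ v x}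

variable (n) in
/-- `P v` has the properties of a multiple of `|dv|²` with respect to some metric that the
localization of the Yamabe functional needs. -/
structure IsGradTerm (P : (M → ℝ) → M → ℝ) : Prop where
  continuous : ∀ v, ContMDiff (𝓡 n) 𝓘(ℝ, ℝ) ∞ v → Continuous (P v)
  nonneg : ∀ v x, 0 ≤ P v x
  eq_zero : ∀ v x, v =ᶠ[𝓝 x] 0 → P v x = 0
  cos_mul_le : ∀ v θ x, ContMDiff (𝓡 n) 𝓘(ℝ, ℝ) ∞ v → ContMDiff (𝓡 n) 𝓘(ℝ, ℝ) ∞ θ →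
    P (fun z ↦ Real.cos (θ z) * v z) x ≤
      (1 - Real.sin (θ x) ^ 2 / 2) * P v x + 2 * v x ^ 2 * P θ x

/-- The cutoff is an angle: `cos θ` then vanishes on `A` and is `1` off `B`, and `sin² θ = 1 - cos²
θ` is the complementary weight, both smooth. -/
theorem exists_cutoff [T2Space M] [SigmaCompactSpace M] {A B : Set M} (hA : IsClosed A)
    (hAB : A ⊆ interior B) : ∃ θ : M → ℝ, ContMDiff (𝓡 n) 𝓘(ℝ, ℝ) ∞ θ ∧
      (∀ x ∈ A, θ x = Real.pi / 2) ∧ (∀ x ∉ B, θ x = 0) ∧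
      ∀ x, 0 ≤ θ x ∧ θ x ≤ Real.pi / 2 := by
  obtain ⟨f, hf0, hf1, hf⟩ := exists_contMDiffMap_zero_one_of_isClosed (n := ⊤) (𝓡 n)
    (isOpen_interior (s := B)).isClosed_compl hA
    (Set.disjoint_left.2 fun x hx hxA ↦ hx (hAB hxA))
  refine ⟨fun x ↦ Real.pi / 2 * f x, ?_, fun x hx ↦ ?_, fun x hx ↦ ?_, fun x ↦ ⟨?_, ?_⟩⟩
  · exact contMDiff_const.mul f.contMDiff
  · simp [hf1 hx]
  · simp [hf0 (fun h ↦ hx (interior_subset h) : x ∈ (interior B)ᶜ)]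
  · exact mul_nonneg (by positivity) (hf x).1
  · exact mul_le_of_le_one_right (by positivity) (hf x).2

variable [T2Space M]

theorem IsGradTerm.hasCompactSupport {P : (M → ℝ) → M → ℝ} (hP : IsGradTerm n P) {v : M → ℝ}
    (hv : HasCompactSupport v) : HasCompactSupport (P v) := by
  refine HasCompactSupport.intro hv fun x hx ↦ hP.eq_zero v x ?_
  exact notMem_tsupport_iff_eventuallyEq.1 hx

variable [MeasurableSpace M] [BorelSpace M]

section Energy

variable {μ : Measure M} [IsFiniteMeasureOnCompacts μ] {P : (M → ℝ) → M → ℝ} {S v : M → ℝ}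

theorem IsGradTerm.integrable_mul (hP : IsGradTerm n P) (hv : v ∈ nonnegTest n M) {f : M → ℝ}
    (hf : Continuous f) : Integrable (fun x ↦ f x * P v x) μ :=
  (hf.mul (hP.continuous v hv.1)).integrable_of_hasCompactSupport
    ((hP.hasCompactSupport hv.2.1).mul_left)

theorem continuous_of_mem_nonnegTest (hv : v ∈ nonnegTest n M) : Continuous v :=
  hv.1.continuous

theorem hasCompactSupport_sq (hv : v ∈ nonnegTest n M) : HasCompactSupport fun x ↦ v x ^ 2 :=
  HasCompactSupport.intro hv.2.1 fun x hx ↦ by simp [image_eq_zero_of_notMem_tsupport hx]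

theorem hasCompactSupport_rpow {p : ℝ} (hp : 0 < p) (hv : v ∈ nonnegTest n M) :
    HasCompactSupport fun x ↦ v x ^ p :=
  HasCompactSupport.intro hv.2.1 fun x hx ↦ by
    rw [image_eq_zero_of_notMem_tsupport hx, Real.zero_rpow hp.ne']

theorem integrable_mul_sq (hv : v ∈ nonnegTest n M) {f : M → ℝ} (hf : Continuous f) :
    Integrable (fun x ↦ f x * v x ^ 2) μ :=
  (hf.mul ((continuous_of_mem_nonnegTest hv).pow 2)).integrable_of_hasCompactSupport
    (hasCompactSupport_sq hv).mul_left

theorem IsGradTerm.integrable_energy (hP : IsGradTerm n P) (hS : Continuous S)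
    (hv : v ∈ nonnegTest n M) : Integrable (fun x ↦ P v x + S x * v x ^ 2) μ := by
  have h1 := hP.integrable_mul (μ := μ) hv (f := fun _ ↦ 1) continuous_const
  simp only [one_mul] at h1
  exact h1.add (integrable_mul_sq hv hS)

theorem integrable_rpow {p : ℝ} (hp : 0 < p) (hv : v ∈ nonnegTest n M) {f : M → ℝ}
    (hf : Continuous f) : Integrable (fun x ↦ f x * v x ^ p) μ := by
  exact (hf.mul ((continuous_of_mem_nonnegTest hv).rpow_const
    fun _ ↦ Or.inr hp.le)).integrable_of_hasCompactSupport (hasCompactSupport_rpow hp hv).mul_left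

/-- Hölder for `v²` and the indicator of `K` with exponents `p / 2` and its conjugate; the second
factor is finite since `K` has finite measure. -/
theorem exists_setIntegral_sq_le {p : ℝ} (hp : 2 < p) {K : Set M} (hK : IsCompact K) :
    ∃ m, 0 ≤ m ∧ ∀ v ∈ nonnegTest n M,
      ∫ x, K.indicator 1 x * v x ^ 2 ∂μ ≤ m * (∫ x, v x ^ p ∂μ) ^ (2 / p) := by
  have hKm : MeasurableSet K := hK.isClosed.measurableSet
  have hr : 1 < p / 2 := by linarith
  have hpq := Real.HolderConjugate.conjExponent hr
  set q := (p / 2).conjExponent with hq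
  refine ⟨(∫ x, (K.indicator 1 x : ℝ) ^ q ∂μ) ^ (1 / q), ?_, fun v hv ↦ ?_⟩
  · refine Real.rpow_nonneg (integral_nonneg fun x ↦ Real.rpow_nonneg ?_ _) _
    exact Set.indicator_nonneg (fun _ _ ↦ zero_le_one) x
  · have hf : MemLp (fun x ↦ v x ^ 2) (ENNReal.ofReal (p / 2)) μ :=
      ((continuous_of_mem_nonnegTest hv).pow 2).memLp_of_hasCompactSupport
        (hasCompactSupport_sq hv)
    have hg : MemLp (K.indicator (1 : M → ℝ)) (ENNReal.ofReal q) μ :=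
      memLp_indicator_const _ hKm (1 : ℝ) (Or.inr hK.measure_lt_top.ne)
    have h := integral_mul_le_Lp_mul_Lq_of_nonneg hpq
      (Filter.Eventually.of_forall fun x ↦ sq_nonneg (v x))
      (Filter.Eventually.of_forall fun x ↦ Set.indicator_nonneg (fun _ _ ↦ zero_le_one) x) hf hg
    have e1 : ∀ x, (v x ^ 2) ^ (p / 2) = v x ^ p := fun x ↦ by
      rw [← Real.rpow_natCast, ← Real.rpow_mul (hv.2.2 x)]
      congr 1
      push_cast
      ring
    simp only [e1, one_div_div] at h
    rw [mul_comm]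
    refine le_trans (le_of_eq ?_) h
    exact integral_congr_ae (Filter.Eventually.of_forall fun x ↦ mul_comm _ _)

/-- A lower bound of the Yamabe functional persists under a perturbation which decays fast enough
at infinity. -/
theorem energy_lower_bound {P' : (M → ℝ) → M → ℝ} {S' : M → ℝ} (K : CompactExhaustion M)
    {θ : ℕ → M → ℝ} (hθs : ∀ i, ContMDiff (𝓡 n) 𝓘(ℝ, ℝ) ∞ (θ i))
    (hθ1 : ∀ i, ∀ x ∈ K i, θ i x = Real.pi / 2) (hθ0 : ∀ i, ∀ x ∉ K (i + 1), θ i x = 0)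
    (hθ : ∀ i x, 0 ≤ θ i x ∧ θ i x ≤ Real.pi / 2)
    {p : ℝ} (hp : 2 < p) {η B m : ℕ → ℝ} (hη : ∀ i, 0 ≤ η i) (hB0 : ∀ i, 0 ≤ B i)
    (hm : ∀ i, ∀ v ∈ nonnegTest n M, ∫ x, (K (i + 1)).indicator 1 x * v x ^ 2 ∂μ ≤
      m i * (∫ x, v x ^ p ∂μ) ^ (2 / p))
    (hP : IsGradTerm n P) (hP' : IsGradTerm n P') (hS : Continuous S) (hS' : Continuous S')
    (hPP : ∀ v x, P v x ≤ P' v x + η (K.find x) * P v x)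
    (hSS : ∀ x, S x ≤ S' x + η (K.find x) * B (K.find x))
    (hB : ∀ i, ∀ x ∈ K (i + 1), 2 * P (θ i) x + |S x| ≤ B i)
    (hsum1 : ∀ N, ∑ i ∈ Finset.range N, 2 * η i ≤ 1)
    (hsum2 : ∀ N, ∑ i ∈ Finset.range N, 3 * (η i * (B i * m i)) ≤ 1)
    {κ : ℝ} (hκ : 0 ≤ κ)
    (hlow : ∀ v ∈ nonnegTest n M,
      -κ * (∫ x, v x ^ p ∂μ) ^ (2 / p) ≤ ∫ x, (P v x + S x * v x ^ 2) ∂μ)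
    {v : M → ℝ} (hv : v ∈ nonnegTest n M) :
    -(κ + 1) * (∫ x, v x ^ p ∂μ) ^ (2 / p) ≤ ∫ x, (P' v x + S' x * v x ^ 2) ∂μ := by
  set V := (∫ x, v x ^ p ∂μ) ^ (2 / p) with hV
  set E := ∫ x, (P v x + S x * v x ^ 2) ∂μ with hE
  have hp0 : 0 < p := by linarith
  have hV0 : 0 ≤ V := Real.rpow_nonneg (integral_nonneg fun x ↦ Real.rpow_nonneg (hv.2.2 x) _) _
  set s : ℕ → M → ℝ := fun i x ↦ Real.sin (θ i x) ^ 2 with hs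
  have hsc : ∀ i, Continuous (s i) := fun i ↦
    (Real.continuous_sin.comp (hθs i).continuous).pow 2
  have hPi : ∀ i, Integrable (fun x ↦ s i x * P v x) μ := fun i ↦ hP.integrable_mul hv (hsc i)
  have hIi : ∀ i, Integrable (fun x ↦ (K (i + 1)).indicator 1 x * v x ^ 2) μ := by
    intro i
    have h := (integrable_mul_sq (μ := μ) hv (f := fun _ ↦ 1) continuous_const).indicator
      ((K.isCompact (i + 1)).isClosed.measurableSet)
    refine h.congr (Filter.Eventually.of_forall fun x ↦ ?_)
    by_cases hx : x ∈ K (i + 1) <;> simp [hx]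
  have hEi := hP.integrable_energy (μ := μ) hS hv
  have hEi' := hP'.integrable_energy (μ := μ) hS' hv
  -- localization
  have hloc : ∀ i, (∫ x, s i x * P v x ∂μ) ≤ 2 * (E + κ * V) + 2 * (B i * m i) * V := by
    intro i
    -- This function may vanish identically, which is why `nonnegTest` admits zero. Since `0 ≤ cos ≤
    -- 1`, its `L^p` norm does not exceed that of `v`.
    set w : M → ℝ := fun z ↦ Real.cos (θ i z) * v z with hw
    have hcos : ∀ x, 0 ≤ Real.cos (θ i x) := fun x ↦
      Real.cos_nonneg_of_neg_pi_div_two_le_of_le (by linarith [(hθ i x).1, Real.pi_pos])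
        (hθ i x).2
    have hwt : w ∈ nonnegTest n M := by
      refine ⟨?_, hv.2.1.mul_left, fun x ↦ mul_nonneg (hcos x) (hv.2.2 x)⟩
      exact (Real.contDiff_cos.contMDiff.comp (hθs i)).mul hv.1
    have hwp : (∫ x, w x ^ p ∂μ) ^ (2 / p) ≤ V := by
      refine Real.rpow_le_rpow (integral_nonneg fun x ↦ Real.rpow_nonneg (hwt.2.2 x) _)
        (integral_mono ?_ ?_ fun x ↦ ?_) (by positivity)
      · simpa using integrable_rpow (μ := μ) hp0 hwt (f := fun _ ↦ 1) continuous_const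
      · simpa using integrable_rpow (μ := μ) hp0 hv (f := fun _ ↦ 1) continuous_const
      · exact Real.rpow_le_rpow (hwt.2.2 x)
          (mul_le_of_le_one_left (hv.2.2 x) (Real.cos_le_one _)) hp0.le
    -- On `K (i + 1)` the error terms `2 v² P (θ i)` and `-sin² S v²` are absorbed into `B i v²`.
    -- Off this set `θ i` vanishes near `x`, and `w` has the same energy bound as `v`.
    have hpt : ∀ x, P w x + S x * w x ^ 2 ≤ (P v x + S x * v x ^ 2) - (1 / 2) * (s i x * P v x) +
        B i * ((K (i + 1)).indicator 1 x * v x ^ 2) := by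
      intro x
      have h1 := hP.cos_mul_le v (θ i) x hv.1 (hθs i)
      have h2 : Real.cos (θ i x) ^ 2 = 1 - s i x := by rw [hs, Real.cos_sq']
      have h3 : S x * w x ^ 2 = S x * v x ^ 2 - s i x * S x * v x ^ 2 := by
        rw [hw]
        simp only [mul_pow, h2]
        ring
      by_cases hx : x ∈ K (i + 1)
      · have h4 := hB i x hx
        have h5 : s i x * -S x ≤ |S x| := by
          refine (mul_le_mul_of_nonneg_left (neg_le_abs (S x)) (sq_nonneg _)).trans ?_
          exact mul_le_of_le_one_left (abs_nonneg _) (Real.sin_sq_le_one _)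
        have h6 : (2 * P (θ i) x + s i x * -S x) * v x ^ 2 ≤ B i * v x ^ 2 :=
          mul_le_mul_of_nonneg_right (by linarith) (sq_nonneg _)
        rw [Set.indicator_of_mem hx, Pi.one_apply, h3]
        change P w x ≤ (1 - s i x / 2) * P v x + 2 * v x ^ 2 * P (θ i) x at h1
        linarith
      · have h4 : P (θ i) x = 0 := by
          refine hP.eq_zero _ _ ?_
          filter_upwards [(K.isCompact (i + 1)).isClosed.isOpen_compl.mem_nhds hx] with z hz
          exact hθ0 i z hz
        have h5 : s i x = 0 := by simp [hs, hθ0 i x hx]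
        rw [Set.indicator_of_notMem hx, h3, h5]
        rw [h4] at h1
        change P w x ≤ (1 - s i x / 2) * P v x + 2 * v x ^ 2 * 0 at h1
        rw [h5] at h1
        linarith
    have hint : ∫ x, (P w x + S x * w x ^ 2) ∂μ ≤ E - (1 / 2) * (∫ x, s i x * P v x ∂μ) +
        B i * ∫ x, (K (i + 1)).indicator 1 x * v x ^ 2 ∂μ := by
      have hi1 : Integrable (fun x ↦ P v x + S x * v x ^ 2 - (1 / 2) * (s i x * P v x)) μ :=
        hEi.sub ((hPi i).const_mul _)
      have hi2 := (hIi i).const_mul (B i)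
      rw [hE, ← integral_const_mul, ← integral_const_mul, ← integral_sub hEi ((hPi i).const_mul _),
        ← integral_add hi1 hi2]
      exact integral_mono (hP.integrable_energy hS hwt) (hi1.add hi2) hpt
    have h7 := hlow w hwt
    have h8 := mul_le_mul_of_nonneg_left hwp hκ
    have h9 := mul_le_mul_of_nonneg_left (hm i v hv) (hB0 i)
    linarith
  -- summation over the exhaustion
  obtain ⟨N, hN⟩ := K.exists_superset_of_isCompact hv.2.1
  -- All summands are nonnegative, and the one with index `K.find x` alone covers the error at `x`,
  -- because `sin² (θ i) = 1` on `K i`. Compactness of the support makes the sum finite.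
  have hpt : ∀ x, (P v x + S x * v x ^ 2) - ∑ i ∈ Finset.range (N + 1),
      (η i * (s i x * P v x) + η i * B i * ((K (i + 1)).indicator 1 x * v x ^ 2)) ≤
        P' v x + S' x * v x ^ 2 := by
    intro x
    by_cases hx : x ∈ tsupport v
    · have hf : K.find x ∈ Finset.range (N + 1) :=
        Finset.mem_range_succ_iff.2 (K.mem_iff_find_le.1 (hN hx))
      have h1 := Finset.single_le_sum (f := fun i ↦ η i * (s i x * P v x) +
        η i * B i * ((K (i + 1)).indicator 1 x * v x ^ 2)) (fun i _ ↦ add_nonneg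
          (mul_nonneg (hη i) (mul_nonneg (sq_nonneg _) (hP.nonneg _ _)))
          (mul_nonneg (mul_nonneg (hη i) (hB0 i)) (mul_nonneg
            (Set.indicator_nonneg (fun _ _ ↦ zero_le_one) x) (sq_nonneg _)))) hf
      have h2 : s (K.find x) x = 1 := by simp [hs, hθ1 _ x (K.mem_find x)]
      have h3 : x ∈ K (K.find x + 1) := K.subset_succ _ (K.mem_find x)
      simp only [h2, Set.indicator_of_mem h3, Pi.one_apply, one_mul] at h1
      have h4 := hPP v x
      have h5 := mul_le_mul_of_nonneg_right (hSS x) (sq_nonneg (v x))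
      linarith
    · have h0 := notMem_tsupport_iff_eventuallyEq.1 hx
      have hv0 : v x = 0 := h0.self_of_nhds
      rw [hP.eq_zero v x h0, hP'.eq_zero v x h0, hv0]
      simp
  have hsumi : ∀ i, Integrable (fun x ↦ η i * (s i x * P v x) +
      η i * B i * ((K (i + 1)).indicator 1 x * v x ^ 2)) μ := fun i ↦
    ((hPi i).const_mul _).add ((hIi i).const_mul _)
  have hint : E - ∑ i ∈ Finset.range (N + 1), (η i * (∫ x, s i x * P v x ∂μ) +
      η i * B i * ∫ x, (K (i + 1)).indicator 1 x * v x ^ 2 ∂μ) ≤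
        ∫ x, (P' v x + S' x * v x ^ 2) ∂μ := by
    have hi1 : Integrable (fun x ↦ ∑ i ∈ Finset.range (N + 1), (η i * (s i x * P v x) +
        η i * B i * ((K (i + 1)).indicator 1 x * v x ^ 2))) μ :=
      integrable_finsetSum (Finset.range (N + 1)) fun i _ ↦ hsumi i
    have hi2 : Integrable (fun x ↦ P v x + S x * v x ^ 2 - ∑ i ∈ Finset.range (N + 1),
        (η i * (s i x * P v x) + η i * B i * ((K (i + 1)).indicator 1 x * v x ^ 2))) μ :=
      hEi.sub hi1
    refine le_trans (le_of_eq ?_) (integral_mono hi2 hEi' hpt)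
    rw [integral_sub hEi hi1, integral_finsetSum _ fun i _ ↦ hsumi i]
    congr 1
    refine Finset.sum_congr rfl fun i _ ↦ ?_
    rw [integral_add ((hPi i).const_mul _) ((hIi i).const_mul _), integral_const_mul,
      integral_const_mul]
  -- The localized gradient contributes `2 η (E + κ V) + 2 η B m V`, the zeroth-order term another
  -- `η B m V`; hence the factors `2` and `3`.
  have hsumle : ∑ i ∈ Finset.range (N + 1), (η i * (∫ x, s i x * P v x ∂μ) +
      η i * B i * ∫ x, (K (i + 1)).indicator 1 x * v x ^ 2 ∂μ) ≤
      (∑ i ∈ Finset.range (N + 1), 2 * η i) * (E + κ * V) +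
        (∑ i ∈ Finset.range (N + 1), 3 * (η i * (B i * m i))) * V := by
    rw [Finset.sum_mul, Finset.sum_mul, ← Finset.sum_add_distrib]
    refine Finset.sum_le_sum fun i _ ↦ ?_
    have h1 := mul_le_mul_of_nonneg_left (hloc i) (hη i)
    have h2 := mul_le_mul_of_nonneg_left (hm i v hv) (mul_nonneg (hη i) (hB0 i))
    linarith
  -- Nonnegativity of `E + κ V` allows its coefficient `∑ 2 η i` to be replaced by `1`; then `E`
  -- cancels from the bound.
  have hE0 : 0 ≤ E + κ * V := by linarith [hlow v hv]
  have h1 := mul_le_mul_of_nonneg_right (hsum1 (N + 1)) hE0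
  have h2 := mul_le_mul_of_nonneg_right (hsum2 (N + 1)) hV0
  linarith

end Energy

end Analysis

/-! ### Comparison of Yamabe functionals of nearby metrics -/

section Comparison

variable {n : ℕ} {M : Type*} [TopologicalSpace M] [ChartedSpace (EuclideanSpace ℝ (Fin n)) M]
  [IsManifold (𝓡 n) ∞ M]

theorem normSqDiff_eq_zero (k : Metr n M) {v : M → ℝ} {x : M} (h : v =ᶠ[𝓝 x] 0) :
    normSqDiff k v x = 0 := by
  refine le_antisymm (normSqDiff_le k v x le_rfl fun X ↦ ?_) (normSqDiff_nonneg k v x)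
  have h1 : diffForm (n := n) v x = 0 := by
    have h2 : HasMFDerivAt (𝓡 n) 𝓘(ℝ, ℝ) v x (0 : EuclideanSpace ℝ (Fin n) →L[ℝ] ℝ) :=
      (hasMFDerivAt_const (0 : ℝ) x).congr_of_eventuallyEq h
    exact h2.mfderiv
  rw [h1]
  simp

theorem diffForm_cos_mul {v θ : M → ℝ} {x : M} (hv : ContMDiff (𝓡 n) 𝓘(ℝ, ℝ) ∞ v)
    (hθ : ContMDiff (𝓡 n) 𝓘(ℝ, ℝ) ∞ θ) (X : EuclideanSpace ℝ (Fin n)) :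
    diffForm (fun z ↦ Real.cos (θ z) * v z) x X =
      Real.cos (θ x) * diffForm v x X - v x * Real.sin (θ x) * diffForm θ x X := by
  have h1 : HasMFDerivAt (𝓡 n) 𝓘(ℝ, ℝ) v x (diffForm v x) :=
    ((hv x).mdifferentiableAt (by simp)).hasMFDerivAt
  have h2 : HasMFDerivAt (𝓡 n) 𝓘(ℝ, ℝ) θ x (diffForm θ x) :=
    ((hθ x).mdifferentiableAt (by simp)).hasMFDerivAt
  have h3 : HasMFDerivAt (𝓡 n) 𝓘(ℝ, ℝ) (Real.cos ∘ θ) x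
      ((-Real.sin (θ x)) • diffForm θ x : EuclideanSpace ℝ (Fin n) →L[ℝ] ℝ) := by
    have h4 := (Real.hasDerivAt_cos (θ x)).hasFDerivAt.hasMFDerivAt.comp x h2
    have h5 : ((-Real.sin (θ x)) • diffForm θ x : EuclideanSpace ℝ (Fin n) →L[ℝ] ℝ) =
        (ContinuousLinearMap.toSpanSingleton ℝ (-Real.sin (θ x))).comp (diffForm θ x) := by
      ext Y
      change -Real.sin (θ x) * diffForm θ x Y = diffForm θ x Y * -Real.sin (θ x)
      ring
    rw [h5]
    exact h4
  have h5 := (h3.mul h1).mfderiv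
  have h6 : diffForm (fun z ↦ Real.cos (θ z) * v z) x =
      (Real.cos (θ x) • diffForm v x + v x • ((-Real.sin (θ x)) • diffForm θ x) :
        EuclideanSpace ℝ (Fin n) →L[ℝ] ℝ) := h5
  rw [h6]
  simp
  ring

/-- Since `d(cos θ · v) = cos θ dv - v sin θ dθ`, Young's inequality for the cross term spends only
half of the gain `sin² θ |dv|²`. The other half remains and is what controls the gradient locally.
-/
theorem normSqDiff_cos_mul_le (k : Metr n M) {v θ : M → ℝ} (x : M)
    (hv : ContMDiff (𝓡 n) 𝓘(ℝ, ℝ) ∞ v) (hθ : ContMDiff (𝓡 n) 𝓘(ℝ, ℝ) ∞ θ) :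
    normSqDiff k (fun z ↦ Real.cos (θ z) * v z) x ≤
      (1 - Real.sin (θ x) ^ 2 / 2) * normSqDiff k v x + 2 * v x ^ 2 * normSqDiff k θ x := by
  have hs := Real.sin_sq_le_one (θ x)
  have h1 : 0 ≤ 1 - Real.sin (θ x) ^ 2 / 2 := by linarith
  refine normSqDiff_le k _ x (add_nonneg (mul_nonneg h1 (normSqDiff_nonneg k v x))
    (mul_nonneg (by positivity) (normSqDiff_nonneg k θ x))) fun X ↦ ?_
  rw [diffForm_cos_mul hv hθ]
  have h2 := mul_le_mul_of_nonneg_left (diffForm_sq_le k v x X) h1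
  have h3 := mul_le_mul_of_nonneg_left (diffForm_sq_le k θ x X)
    (by positivity : 0 ≤ 2 * v x ^ 2)
  have h4 := Real.cos_sq' (θ x)
  set c := Real.cos (θ x)
  set s := Real.sin (θ x)
  set α := diffForm v x X
  set β := diffForm θ x X
  -- Completing the square; the last summand vanishes by `cos² = 1 - sin²`.
  have h5 : (c * α - v x * s * β) ^ 2 =
      (1 - s ^ 2 / 2) * α ^ 2 + 2 * v x ^ 2 * β ^ 2 -
        ((s * α + 2 * c * (v x * β)) ^ 2 / 2 + s ^ 2 * (v x * β) ^ 2) +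
        (c ^ 2 - (1 - s ^ 2)) * (α ^ 2 + 2 * (v x * β) ^ 2) := by ring
  rw [h5, h4, sub_self, zero_mul, add_zero]
  have h6 : 0 ≤ (s * α + 2 * c * (v x * β)) ^ 2 / 2 + s ^ 2 * (v x * β) ^ 2 := by positivity
  linarith

/-- The gradient part of the numerator of the Yamabe functional of `k`, as a density with respect
to the volume measure of `g`. -/
def gradTerm (g k : Metr n M) (v : M → ℝ) (x : M) : ℝ :=
  volRatio g k x * (4 * ((n : ℝ) - 1) / ((n : ℝ) - 2) * normSqDiff k v x)

/-- The coefficient of `v²` in the numerator of the Yamabe functional of `k`, as a density with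
respect to the volume measure of `g`. -/
def scalTerm (g k : Metr n M) (x : M) : ℝ := volRatio g k x * scal k x

theorem yamabeCoeff_pos (hn : 3 ≤ n) : 0 < 4 * ((n : ℝ) - 1) / ((n : ℝ) - 2) := by
  have : (3 : ℝ) ≤ n := by exact_mod_cast hn
  exact div_pos (by linarith) (by linarith)

theorem two_lt_yamabeExp (hn : 3 ≤ n) : 2 < 2 * (n : ℝ) / ((n : ℝ) - 2) := by
  have : (3 : ℝ) ≤ n := by exact_mod_cast hn
  rw [lt_div_iff₀ (by linarith)]
  linarith

theorem continuous_scalTerm (g k : Metr n M) : Continuous (scalTerm g k) :=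
  (continuous_volRatio g k).mul (continuous_scal k)

theorem isGradTerm_gradTerm (hn : 3 ≤ n) (g k : Metr n M) : IsGradTerm n (gradTerm g k) where
  continuous v hv := (continuous_volRatio g k).mul
    (continuous_const.mul (continuous_normSqDiff (by omega) k hv))
  nonneg v x := mul_nonneg (volRatio_pos g k x).le
    (mul_nonneg (yamabeCoeff_pos hn).le (normSqDiff_nonneg k v x))
  eq_zero v x h := by rw [gradTerm, normSqDiff_eq_zero k h, mul_zero, mul_zero]
  cos_mul_le v θ x hv hθ := by
    have h1 := mul_le_mul_of_nonneg_left (normSqDiff_cos_mul_le k x hv hθ)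
      (mul_nonneg (volRatio_pos g k x).le (yamabeCoeff_pos hn).le)
    simp only [gradTerm]
    linarith

theorem volRatio_self (g : Metr n M) (x : M) : volRatio g g x = 1 := by
  have hm := (chartAt (EuclideanSpace ℝ (Fin n)) x).map_source (mem_chart_source _ x)
  rw [volRatio, volRatioIn, div_self (metricCoeff_det_pos (chart_mem_atlas _ x) g hm).ne',
    Real.sqrt_one]

namespace CloseAt

variable {g k : Metr n M} {ε : ℝ} {x : M}

theorem refl (g : Metr n M) (x : M) (hε : 0 ≤ ε) : CloseAt g g ε x where
  inner_le X := by
    rw [sub_self, abs_zero]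
    exact mul_nonneg hε ((isPosQuad_inner g x).nonneg X)
  scal_le := by rwa [sub_self, abs_zero]
  vol_le := by rwa [volRatio_self, sub_self, abs_zero]

theorem volRatio_bounds (hc : CloseAt g k ε x) (hε : ε ≤ 1 / 8) :
    1 / 2 ≤ volRatio g k x ∧ volRatio g k x ≤ 2 := by
  have := abs_le.1 hc.vol_le
  constructor <;> linarith

/-- Dual norms reverse inequalities between metrics: an upper bound on `k` by `g` bounds the dual
norm of `g` by that of `k`. -/
theorem normSqDiff_le_mul (hc : CloseAt g k ε x) (hε0 : 0 ≤ ε) (v : M → ℝ) :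
    normSqDiff g v x ≤ (1 + ε) * normSqDiff k v x := by
  have h0 := normSqDiff_nonneg k v x
  refine normSqDiff_le g v x (by positivity) fun X ↦ (diffForm_sq_le k v x X).trans ?_
  have h1 := (abs_le.1 (hc.inner_le X)).2
  have h2 : k.inner x X X ≤ (1 + ε) * g.inner x X X := by linarith
  have h3 := mul_le_mul_of_nonneg_left h2 h0
  linarith

theorem mul_normSqDiff_le (hc : CloseAt g k ε x) (hε : ε ≤ 1 / 8) (v : M → ℝ) :
    (1 - ε) * normSqDiff k v x ≤ normSqDiff g v x := by
  have hpos : 0 < 1 - ε := by linarith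
  rw [mul_comm, ← le_div_iff₀ hpos]
  have h0 := normSqDiff_nonneg g v x
  refine normSqDiff_le k v x (div_nonneg h0 hpos.le) fun X ↦ (diffForm_sq_le g v x X).trans ?_
  have h1 := (abs_le.1 (hc.inner_le X)).1
  have h2 : (1 - ε) * g.inner x X X ≤ k.inner x X X := by linarith
  have h3 := mul_le_mul_of_nonneg_left h2 h0
  rw [div_mul_eq_mul_div, le_div_iff₀ hpos]
  linarith

/-- The volume ratio and the dual norm each contribute a relative error of order `ε`. The constants
work because `(1 - 2ε)(1 + ε) ≤ 1 - ε` and `1 + ε ≤ (1 + 4ε)(1 - ε)` for `0 ≤ ε ≤ 1/8`. -/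
theorem gradTerm_bounds (hn : 3 ≤ n) (hc : CloseAt g k ε x) (hε0 : 0 ≤ ε) (hε : ε ≤ 1 / 8)
    (v : M → ℝ) : (1 - 2 * ε) * gradTerm g g v x ≤ gradTerm g k v x ∧
      gradTerm g k v x ≤ (1 + 4 * ε) * gradTerm g g v x := by
  have ha := (yamabeCoeff_pos hn).le
  obtain ⟨hr1, hr2⟩ := abs_le.1 hc.vol_le
  have h1 := hc.normSqDiff_le_mul hε0 v
  have h2 := hc.mul_normSqDiff_le hε v
  have hg0 := normSqDiff_nonneg g v x
  have hk0 := normSqDiff_nonneg k v x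
  simp only [gradTerm, volRatio_self]
  set a := 4 * ((n : ℝ) - 1) / ((n : ℝ) - 2)
  set r := volRatio g k x
  set N := normSqDiff g v x
  set N' := normSqDiff k v x
  have key1 : (1 - 2 * ε) * N ≤ r * N' := by
    calc (1 - 2 * ε) * N ≤ (1 - 2 * ε) * ((1 + ε) * N') :=
          mul_le_mul_of_nonneg_left h1 (by linarith)
      _ ≤ (1 - ε) * N' := by nlinarith [mul_nonneg (mul_nonneg hε0 hε0) hk0]
      _ ≤ r * N' := mul_le_mul_of_nonneg_right (by linarith) hk0
  have key2 : r * N' ≤ (1 + 4 * ε) * N := by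
    calc r * N' ≤ (1 + ε) * N' := mul_le_mul_of_nonneg_right (by linarith) hk0
      _ ≤ (1 + 4 * ε) * ((1 - ε) * N') := by
          have h3 : 1 + ε ≤ (1 + 4 * ε) * (1 - ε) := by nlinarith
          rw [← mul_assoc]
          exact mul_le_mul_of_nonneg_right h3 hk0
      _ ≤ (1 + 4 * ε) * N := mul_le_mul_of_nonneg_left h2 (by linarith)
  have h4 := mul_le_mul_of_nonneg_left key1 ha
  have h5 := mul_le_mul_of_nonneg_left key2 ha
  constructor <;> linarith

theorem scalTerm_bound (hc : CloseAt g k ε x) (hε : ε ≤ 1 / 8) :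
    |scalTerm g k x - scal g x| ≤ ε * (2 + |scal g x|) := by
  obtain ⟨hr1, hr2⟩ := hc.volRatio_bounds hε
  -- Separates the error of the scalar curvature from that of the volume density.
  have h1 : scalTerm g k x - scal g x =
      volRatio g k x * (scal k x - scal g x) + (volRatio g k x - 1) * scal g x := by
    rw [scalTerm]; ring
  rw [h1]
  refine (abs_add_le _ _).trans ?_
  rw [abs_mul, abs_mul, abs_of_pos (volRatio_pos g k x)]
  have h2 := mul_le_mul hr2 hc.scal_le (abs_nonneg _) zero_le_two
  have h3 := mul_le_mul_of_nonneg_right hc.vol_le (abs_nonneg (scal g x))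
  linarith

end CloseAt

section Measure

variable [SecondCountableTopology M] [Nonempty M] [MeasurableSpace M] [BorelSpace M]

theorem integral_volMeasure_eq (g k : Metr n M) (f : M → ℝ) :
    ∫ x, f x ∂(volMeasure k) = ∫ x, volRatio g k x * f x ∂(volMeasure g) := by
  rw [volMeasure_eq_withDensity g k, integral_withDensity_eq_integral_toReal_smul
    (continuous_volRatio g k).measurable.ennreal_ofReal
    (Filter.Eventually.of_forall fun _ ↦ ENNReal.ofReal_lt_top)]
  refine integral_congr_ae (Filter.Eventually.of_forall fun x ↦ ?_)
  simp only [smul_eq_mul]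
  rw [ENNReal.toReal_ofReal (volRatio_pos g k x).le]

variable [T2Space M]

/-- Finiteness of the Yamabe constant in terms of the energy. -/
theorem yamabeConstant_ne_bot_iff (hn : 3 ≤ n) (g k : Metr n M)
    (hr : ∀ x, 1 / 2 ≤ volRatio g k x ∧ volRatio g k x ≤ 2) :
    yamabeConstant k ≠ ⊥ ↔ ∃ κ : ℝ, 0 ≤ κ ∧ ∀ v ∈ nonnegTest n M,
      -κ * (∫ x, v x ^ (2 * (n : ℝ) / ((n : ℝ) - 2)) ∂(volMeasure g)) ^
        (2 / (2 * (n : ℝ) / ((n : ℝ) - 2))) ≤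
        ∫ x, (gradTerm g k v x + scalTerm g k x * v x ^ 2) ∂(volMeasure g) := by
  have hp2 := two_lt_yamabeExp hn
  have ha := yamabeCoeff_pos hn
  have := isFiniteMeasureOnCompacts_volMeasure g
  set p := 2 * (n : ℝ) / ((n : ℝ) - 2) with hp
  have hp0 : 0 < p := by linarith
  -- The volume ratio lies in `[1/2, 2]`, so the squared `L^p` norms for `k` and `g` differ by at
  -- most this factor.
  set C : ℝ := 2 ^ (2 / p) with hC
  have hC0 : 0 < C := Real.rpow_pos_of_pos two_pos _
  have hcont := continuous_volRatio g k
  have hnum : ∀ v : M → ℝ, ∫ x, (4 * ((n : ℝ) - 1) / ((n : ℝ) - 2) * normSqDiff k v x +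
      scal k x * v x ^ 2) ∂(volMeasure k) =
      ∫ x, (gradTerm g k v x + scalTerm g k x * v x ^ 2) ∂(volMeasure g) := by
    intro v
    rw [integral_volMeasure_eq g k]
    refine integral_congr_ae (Filter.Eventually.of_forall fun x ↦ ?_)
    simp only [gradTerm, scalTerm]
    ring
  have hfun : ∀ v ∈ nonnegTest n M, yamabeFunctional k v =
      (∫ x, (gradTerm g k v x + scalTerm g k x * v x ^ 2) ∂(volMeasure g)) /
        (∫ x, volRatio g k x * v x ^ p ∂(volMeasure g)) ^ (2 / p) := by
    intro v hv
    have h0 : 0 ≤ ∫ x, volRatio g k x * v x ^ p ∂(volMeasure g) :=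
      integral_nonneg fun x ↦ mul_nonneg (volRatio_pos g k x).le (Real.rpow_nonneg (hv.2.2 x) _)
    simp only [yamabeFunctional]
    rw [hnum v, integral_volMeasure_eq g k, ← hp, ← Real.rpow_natCast, ← Real.rpow_mul h0]
    congr 2
    push_cast
    ring
  set V : (M → ℝ) → ℝ := fun v ↦ (∫ x, v x ^ p ∂(volMeasure g)) ^ (2 / p) with hV
  set D : (M → ℝ) → ℝ := fun v ↦ (∫ x, volRatio g k x * v x ^ p ∂(volMeasure g)) ^ (2 / p)
    with hD
  have hVint : ∀ v ∈ nonnegTest n M, Integrable (fun x ↦ v x ^ p) (volMeasure g) := fun v hv ↦ by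
    simpa using integrable_rpow (μ := volMeasure g) hp0 hv (f := fun _ ↦ 1) continuous_const
  have hV0 : ∀ v ∈ nonnegTest n M, 0 ≤ ∫ x, v x ^ p ∂(volMeasure g) := fun v hv ↦
    integral_nonneg fun x ↦ Real.rpow_nonneg (hv.2.2 x) _
  have hD0 : ∀ v ∈ nonnegTest n M, 0 ≤ ∫ x, volRatio g k x * v x ^ p ∂(volMeasure g) :=
    fun v hv ↦ integral_nonneg fun x ↦
      mul_nonneg (volRatio_pos g k x).le (Real.rpow_nonneg (hv.2.2 x) _)
  have hDV : ∀ v ∈ nonnegTest n M, D v ≤ C * V v := by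
    intro v hv
    rw [hC, hV, hD, ← Real.mul_rpow zero_le_two (hV0 v hv), ← integral_const_mul]
    refine Real.rpow_le_rpow (hD0 v hv) (integral_mono (integrable_rpow hp0 hv hcont)
      ((hVint v hv).const_mul _) fun x ↦ ?_) (by positivity)
    exact mul_le_mul_of_nonneg_right (hr x).2 (Real.rpow_nonneg (hv.2.2 x) _)
  have hVD : ∀ v ∈ nonnegTest n M, V v ≤ C * D v := by
    intro v hv
    rw [hC, hV, hD, ← Real.mul_rpow zero_le_two (hD0 v hv), ← integral_const_mul]
    refine Real.rpow_le_rpow (hV0 v hv) (integral_mono (hVint v hv)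
      ((integrable_rpow hp0 hv hcont).const_mul _) fun x ↦ ?_) (by positivity)
    have := mul_le_mul_of_nonneg_right (hr x).1 (Real.rpow_nonneg (hv.2.2 x) p)
    change v x ^ p ≤ 2 * (volRatio g k x * v x ^ p)
    linarith
  have hDnn : ∀ v ∈ nonnegTest n M, 0 ≤ D v := fun v hv ↦ Real.rpow_nonneg (hD0 v hv) _
  have hVnn : ∀ v ∈ nonnegTest n M, 0 ≤ V v := fun v hv ↦ Real.rpow_nonneg (hV0 v hv) _
  constructor
  · intro hne
    obtain ⟨c, -, hc⟩ := EReal.lt_iff_exists_real_btwn.1 (bot_lt_iff_ne_bot.2 hne)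
    refine ⟨|c| * C, by positivity, fun v hv ↦ ?_⟩
    change -(|c| * C) * V v ≤ _
    -- If the denominator vanishes, then `v = 0` almost everywhere and the numerator reduces to the
    -- nonnegative gradient term. Positivity of the measure on open sets is not needed.
    rcases (hDnn v hv).eq_or_lt with h0 | hpos
    · have hVz : V v = 0 := le_antisymm (by simpa [← h0] using hVD v hv) (hVnn v hv)
      rw [hVz, mul_zero]
      have hz : ∫ x, v x ^ p ∂(volMeasure g) = 0 := by
        by_contra hne0
        exact hne0 ((Real.rpow_eq_zero (hV0 v hv) (by positivity)).1 hVz)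
      have hae := (integral_eq_zero_iff_of_nonneg
        (fun x ↦ Real.rpow_nonneg (hv.2.2 x) p) (hVint v hv)).1 hz
      refine integral_nonneg_of_ae ?_
      filter_upwards [hae] with x hx
      have hvx : v x = 0 := (Real.rpow_eq_zero (hv.2.2 x) hp0.ne').1 hx
      rw [hvx]
      simpa using (isGradTerm_gradTerm hn g k).nonneg v x
    · have hvne : v ≠ 0 := by
        rintro rfl
        have h0 : D 0 = 0 := by
          simp only [hD, Pi.zero_apply, Real.zero_rpow hp0.ne', mul_zero, integral_zero]
          exact Real.zero_rpow (by positivity)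
        exact hpos.ne' h0
      have h1 : (c : EReal) ≤ (yamabeFunctional k v : ℝ) :=
        hc.le.trans (iInf₂_le v ⟨hv.1, hv.2.1, hv.2.2, hvne⟩)
      have h2 : c ≤ yamabeFunctional k v := EReal.coe_le_coe_iff.1 h1
      rw [hfun v hv, le_div_iff₀ hpos] at h2
      have h3 := mul_le_mul_of_nonneg_right (neg_abs_le c) hpos.le
      have h4 := mul_le_mul_of_nonneg_left (hDV v hv) (abs_nonneg c)
      change c * D v ≤ _ at h2
      linarith
  · rintro ⟨κ, hκ, hlow⟩
    have h1 : ((-(κ * C) : ℝ) : EReal) ≤ yamabeConstant k := by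
      refine le_iInf₂ fun v hv ↦ ?_
      have hv' : v ∈ nonnegTest n M := ⟨hv.1, hv.2.1, hv.2.2.1⟩
      rw [EReal.coe_le_coe_iff, hfun v hv']
      change -(κ * C) ≤ _ / D v
      rcases (hDnn v hv').eq_or_lt with h0 | hpos
      -- With zero denominator the quotient has the default value `0`, which respects the
      -- nonpositive bound.
      · rw [← h0, div_zero]
        exact neg_nonpos.2 (by positivity)
      · rw [le_div_iff₀ hpos]
        have h2 : -κ * V v ≤ _ := hlow v hv'
        have h3 := mul_le_mul_of_nonneg_left (hVD v hv') hκ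
        linarith
    exact ((EReal.bot_lt_coe _).trans_le h1).ne'

/-- Cutoffs, Hölder constants and bounds `B` are chosen for `g` only, with enough room in `B` to
serve every `k` that is close to `g`. The tolerance `ε` thus precedes `k` and `k'`, whose roles are
symmetric. -/
theorem exists_closeness (hn : 3 ≤ n) (K : CompactExhaustion M) (g : Metr n M) :
    ∃ ε : ℕ → ℝ, (∀ i, 0 < ε i) ∧ Antitone ε ∧ ∀ k k' : Metr n M,
      (∀ x, CloseAt g k (ε (K.find x)) x) → (∀ x, CloseAt g k' (ε (K.find x)) x) →
      yamabeConstant k ≠ ⊥ → yamabeConstant k' ≠ ⊥ := by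
  have hp2 := two_lt_yamabeExp hn
  have := isFiniteMeasureOnCompacts_volMeasure g
  have : LocallyCompactSpace M :=
    ChartedSpace.locallyCompactSpace (EuclideanSpace ℝ (Fin n)) M
  choose θ hθs hθ1 hθ0 hθ using fun i ↦ exists_cutoff (n := n)
    (K.isCompact i).isClosed (K.subset_interior_succ i)
  choose m hm0 hm using fun i ↦ exists_setIntegral_sq_le (n := n) (μ := volMeasure g) hp2
    (K.isCompact (i + 1))
  -- The terms allow for the passage from `g` to `k`: `2 gradTerm g k ≤ 2 · (3/2) gradTerm g g`, and
  -- `|scalTerm g k| ≤ |scal g| + (2 + |scal g|) / 8`.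
  have hBex : ∀ i, ∃ B, 0 ≤ B ∧ ∀ x ∈ K (i + 1),
      3 * gradTerm g g (θ i) x + 2 * |scal g x| + 2 ≤ B := by
    intro i
    have hc : Continuous fun x ↦ 3 * gradTerm g g (θ i) x + 2 * |scal g x| + 2 :=
      ((continuous_const.mul ((isGradTerm_gradTerm hn g g).continuous _ (hθs i))).add
        (continuous_const.mul (continuous_scal g).abs)).add continuous_const
    obtain ⟨B, hB⟩ := ((K.isCompact (i + 1)).image hc).bddAbove
    exact ⟨max B 0, le_max_right _ _, fun x hx ↦ (hB ⟨x, hx, rfl⟩).trans (le_max_left _ _)⟩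
  choose B hB0 hB using hBex
  -- Partial sums are monotone and dominate each `B i * m i`. Dividing by `1 + T i` therefore makes
  -- `ε` antitone and both `ε i` and `ε i * (B i * m i)` at most `2⁻ⁱ / 64`.
  set T : ℕ → ℝ := fun i ↦ ∑ j ∈ Finset.range (i + 1), B j * m j with hT
  have hBm : ∀ i, 0 ≤ B i * m i := fun i ↦ mul_nonneg (hB0 i) (hm0 i)
  have hT0 : ∀ i, 0 ≤ T i := fun i ↦ Finset.sum_nonneg fun j _ ↦ hBm j
  have hTm : Monotone T := fun i j hij ↦
    Finset.sum_le_sum_of_subset_of_nonneg (Finset.range_mono (by omega)) fun j _ _ ↦ hBm j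
  have hTi : ∀ i, B i * m i ≤ T i := fun i ↦
    Finset.single_le_sum (f := fun j ↦ B j * m j) (fun j _ ↦ hBm j) (Finset.self_mem_range_succ i)
  set ε : ℕ → ℝ := fun i ↦ (1 / 2) ^ i / (64 * (1 + T i)) with hε
  have hεpos : ∀ i, 0 < ε i := fun i ↦
    div_pos (by positivity) (mul_pos (by norm_num) (by linarith [hT0 i]))
  have hεmul : ∀ i, ε i * (1 + T i) = (1 / 64) * (1 / 2) ^ i := fun i ↦ by
    have : 1 + T i ≠ 0 := by linarith [hT0 i]
    rw [hε]
    field_simp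
  have hε1 : ∀ i, ε i ≤ (1 / 64) * (1 / 2) ^ i := fun i ↦ by
    rw [← hεmul]
    exact le_mul_of_one_le_right (hεpos i).le (by linarith [hT0 i])
  have hε2 : ∀ i, ε i * (B i * m i) ≤ (1 / 64) * (1 / 2) ^ i := fun i ↦ by
    rw [← hεmul]
    exact mul_le_mul_of_nonneg_left (by linarith [hTi i]) (hεpos i).le
  have hε8 : ∀ i, ε i ≤ 1 / 8 := fun i ↦ (hε1 i).trans (by
    have : (1 / 2 : ℝ) ^ i ≤ 1 := pow_le_one₀ (by norm_num) (by norm_num)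
    linarith)
  have hgeom : ∀ N, ∑ i ∈ Finset.range N, (1 / 2 : ℝ) ^ i ≤ 2 := fun N ↦
    sum_geometric_two_le N
  refine ⟨ε, hεpos, ?_, fun k k' hk hk' hne ↦ ?_⟩
  · intro i j hij
    refine div_le_div₀ (by positivity) (pow_le_pow_of_le_one (by norm_num) (by norm_num) hij)
      (mul_pos (by norm_num) (by linarith [hT0 i])) ?_
    linarith [hTm hij]
  rw [yamabeConstant_ne_bot_iff hn g k fun x ↦ (hk x).volRatio_bounds (hε8 _)] at hne
  rw [yamabeConstant_ne_bot_iff hn g k' fun x ↦ (hk' x).volRatio_bounds (hε8 _)]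
  obtain ⟨κ, hκ, hlow⟩ := hne
  refine ⟨κ + 1, by linarith, fun v hv ↦ ?_⟩
  have hgk : ∀ v x, gradTerm g k v x ≤ (1 + 4 * ε (K.find x)) * gradTerm g g v x :=
    fun v x ↦ ((hk x).gradTerm_bounds hn (hεpos _).le (hε8 _) v).2
  have hsk : ∀ x, |scalTerm g k x - scal g x| ≤ ε (K.find x) * (2 + |scal g x|) := fun x ↦
    (hk x).scalTerm_bound (hε8 _)
  have hgg0 := (isGradTerm_gradTerm hn g g).nonneg
  -- The factor `6` comes from passing from `k` to `k'` through `g`: `(1 - 6ε)(1 + 4ε) ≤ 1 - 2ε`.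
  -- The scalar curvature only needs `2 ε B`. The two sums are at most `24/64` and `36/64`.
  refine energy_lower_bound K hθs hθ1 hθ0 hθ hp2 (η := fun i ↦ 6 * ε i)
    (fun i ↦ by linarith [hεpos i]) hB0 hm (isGradTerm_gradTerm hn g k)
    (isGradTerm_gradTerm hn g k') (continuous_scalTerm g k) (continuous_scalTerm g k')
    ?_ ?_ ?_ ?_ ?_ hκ hlow hv
  · intro v x
    have h1 := hgk v x
    have h2 := ((hk' x).gradTerm_bounds hn (hεpos _).le (hε8 _) v).1
    have h3 := hgg0 v x
    have h4 := hεpos (K.find x)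
    have h5 := hε8 (K.find x)
    set e := ε (K.find x)
    have h6 : (1 - 6 * e) * gradTerm g k v x ≤ (1 - 6 * e) * ((1 + 4 * e) * gradTerm g g v x) :=
      mul_le_mul_of_nonneg_left h1 (by linarith)
    have h7 : (1 - 6 * e) * (1 + 4 * e) * gradTerm g g v x ≤ (1 - 2 * e) * gradTerm g g v x :=
      mul_le_mul_of_nonneg_right (by nlinarith) h3
    change gradTerm g k v x ≤ gradTerm g k' v x + 6 * e * gradTerm g k v x
    linarith
  · intro x
    have h1 := (abs_le.1 (hsk x)).2
    have h2 := (abs_le.1 ((hk' x).scalTerm_bound (hε8 _))).1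
    have h3 := hB (K.find x) x (K.subset_succ _ (K.mem_find x))
    have h4 := hgg0 (θ (K.find x)) x
    have h5 : ε (K.find x) * (2 + |scal g x|) ≤ ε (K.find x) * B (K.find x) :=
      mul_le_mul_of_nonneg_left (by linarith [abs_nonneg (scal g x)]) (hεpos _).le
    have h6 := mul_nonneg (hεpos (K.find x)).le (hB0 (K.find x))
    change scalTerm g k x ≤ scalTerm g k' x + 6 * ε (K.find x) * B (K.find x)
    linarith
  · intro i x hx
    have h1 := hgk (θ i) x
    have h2 := hB i x hx
    have h3 := hgg0 (θ i) x
    have h4 := hsk x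
    have h5 := hε8 (K.find x)
    have h6 : |scalTerm g k x| ≤ |scal g x| + |scalTerm g k x - scal g x| := by
      have := abs_add_le (scal g x) (scalTerm g k x - scal g x)
      rwa [add_sub_cancel] at this
    have h7 : ε (K.find x) * (2 + |scal g x|) ≤ 1 / 8 * (2 + |scal g x|) :=
      mul_le_mul_of_nonneg_right h5 (by positivity)
    have h8 : (1 + 4 * ε (K.find x)) * gradTerm g g (θ i) x ≤ 3 / 2 * gradTerm g g (θ i) x :=
      mul_le_mul_of_nonneg_right (by linarith) h3
    linarith [abs_nonneg (scal g x)]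
  · intro N
    have h1 : ∑ i ∈ Finset.range N, 2 * (6 * ε i) ≤
        ∑ i ∈ Finset.range N, 12 / 64 * (1 / 2 : ℝ) ^ i :=
      Finset.sum_le_sum fun i _ ↦ by linarith [hε1 i]
    have h2 : ∑ i ∈ Finset.range N, 12 / 64 * (1 / 2 : ℝ) ^ i =
        12 / 64 * ∑ i ∈ Finset.range N, (1 / 2 : ℝ) ^ i := (Finset.mul_sum ..).symm
    rw [h2] at h1
    linarith [hgeom N]
  · intro N
    have h1 : ∑ i ∈ Finset.range N, 3 * (6 * ε i * (B i * m i)) ≤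
        ∑ i ∈ Finset.range N, 18 / 64 * (1 / 2 : ℝ) ^ i :=
      Finset.sum_le_sum fun i _ ↦ by linarith [hε2 i]
    have h2 : ∑ i ∈ Finset.range N, 18 / 64 * (1 / 2 : ℝ) ^ i =
        18 / 64 * ∑ i ∈ Finset.range N, (1 / 2 : ℝ) ^ i := (Finset.mul_sum ..).symm
    rw [h2] at h1
    linarith [hgeom N]

/-- Near every metric, finiteness of the Yamabe constant is constant for the fine
`C²`-topology. -/
theorem exists_isOpen_yamabeConstant_iff (hn : 3 ≤ n) (g : Metr n M) :
    ∃ U : Set (JetBundle n M), IsOpen U ∧ Set.range (jet g) ⊆ U ∧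
      ∀ h : Metr n M, Set.range (jet h) ⊆ U → (yamabeConstant h = ⊥ ↔ yamabeConstant g = ⊥) := by
  have : LocallyCompactSpace M :=
    ChartedSpace.locallyCompactSpace (EuclideanSpace ℝ (Fin n)) M
  let K := CompactExhaustion.choice M
  obtain ⟨ε, hε, hanti, hY⟩ := exists_closeness hn K g
  obtain ⟨U, hU, hgU, hclose⟩ := exists_isOpen_closeAt_exhaustion K g hε hanti
  -- Since `g` is close to itself, the one-sided statement applies to both `(h, g)` and `(g, h)`.
  have hgg : ∀ x, CloseAt g g (ε (K.find x)) x := fun x ↦ CloseAt.refl g x (hε _).le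
  exact ⟨U, hU, hgU, fun h hh ↦ not_iff_not.1
    ⟨hY h g (hclose h hh) hgg, hY g h hgg (hclose h hh)⟩⟩

end Measure

end Comparison

end YamabeConst

end

/-! ### Openness and closedness from local constancy -/

theorem mainTheorem3 (n : ℕ) (hn : 3 ≤ n) (M : Type*) [TopologicalSpace M] [T2Space M]
    [SecondCountableTopology M] [Nonempty M] [ChartedSpace (EuclideanSpace ℝ (Fin n)) M]
    [IsManifold (𝓡 n) ∞ M] [MeasurableSpace M] [BorelSpace M] :
    IsOpen[YamabeConst.fineC2Topology n M]
        {g : Metr n M | YamabeConst.yamabeConstant g = ⊥} ∧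
      IsClosed[YamabeConst.fineC2Topology n M]
        {g : Metr n M | YamabeConst.yamabeConstant g = ⊥} := by
  refine ⟨fun g hg ↦ ?_, ?_⟩
  · obtain ⟨U, hU, hgU, h⟩ := YamabeConst.exists_isOpen_yamabeConstant_iff hn g
    exact ⟨U, hU, hgU, fun k hk ↦ (h k hk).2 hg⟩
  · refine (@isOpen_compl_iff _ _ (YamabeConst.fineC2Topology n M)).1 fun g hg ↦ ?_
    obtain ⟨U, hU, hgU, h⟩ := YamabeConst.exists_isOpen_yamabeConstant_iff hn g
    exact ⟨U, hU, hgU, fun k hk hk' ↦ hg ((h k hk).1 hk')⟩
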